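/- Let $m,n\ge 0$ be integers with $(m,n)\neq(0,0)$; everything is over $\mathbb C$. Let $A_{m,n}=\mathbb C[t_1,\dots,t_m]\otimes\Lambda(\xi_1,\dots,\xi_n)$ and let $W=W_{m,n}$ be the Lie superalgebra of superderivations of $A_{m,n}$. Let $\mathfrak h$ be the span of $d_i=t_i\frac{\partial}{\partial t_i}$, $1\le i\le m$, and let $\epsilon_1,\dots,\epsilon_m\in\mathfrak h^*$ be the dual basis, with $(\epsilon_i,\epsilon_j)=\delta_{ij}$. For $\alpha\in\mathfrak h^*$ let $W_\alpha$ be the $\alpha$-weight space of $W$ under the adjoint action of $\mathfrak h$ (so $W_0$ is the centralizer of $\mathfrak h$), and let $\Delta=\{\alpha\ne 0: W_\alpha\neq0\}$. Put $\Delta'=\{\epsilon_i-\epsilon_j\ (i\ne j),\ \epsilon_i,\ -\epsilon_i\}$. Let $M$ be a simple nontrivial ($\mathbb Z_2$-graded) $W$-module that is the direct sum of its $\mathfrak h$-weight spaces $M_\mu$, all of them finite-dimensional, and let $\operatorname{supp}(M)=\{\mu: M_\mu\ne0\}$. Let $\lambda\in\operatorname{supp}(M)$ be extremal, i.e. $K_\lambda:=\{\alpha\in\Delta'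 : \lambda+\alpha\notin\operatorname{supp}(M)\}$ is not a proper subset of $K_\mu$ for any $\mu\in\operatorname{supp}(M)$. Let $\Delta'^{+}$, $\Delta'^{-}$, $\Delta'^F$, $\Delta'^I$ be the sets of those $\alpha\in\Delta'$ for which $\{r\in\mathbb R:\lambda+r\alpha\in\operatorname{supp}(M)\}$ is, respectively, bounded only from above, bounded only from below, bounded in both directions, unbounded in both directions. Let $P\sqcup N$ be any triangular decomposition of $\{\alpha\in\Delta'^F:(\lambda,\alpha)=0\}$, i.e. the cones $\langle -P\cup N\rangle_{\mathbb R_+}$ and $\langle -N\cup P\rangle_{\mathbb R_+}$ meet only in $0$. Set $${}^\lambda\Delta'^{+}=\Delta'^+\sqcup\{\alpha\in\Delta'^F:(\lambda,\alpha)>0\}\sqcup P,\qquad {}^\lambda\Delta^0=\Delta\cap\langle\Delta'^I\rangle_{\mathbb Z},\qquad {}^\lambda\Delta^+=\bigl(\Delta\cap\langle{}^\lambda\Delta'^+\sqcup\Delta'^I\rangle_{\mathbb Z_+}\bigr)\setminus{}^\lambda\Delta^0 .$$ Let $\hat{\mathfrak k}=W_0\oplus\bigoplus_{\alpha\in{}^\lambda\Delta^0}W_\alpha$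 be the Levi subalgebra of the parabolic subalgebra ${}^\lambda\mathfrak p=\hat{\mathfrak k}\oplus\bigoplus_{\alpha\in{}^\lambda\Delta^+}W_\alpha$ of $W$. Then there are an integer $0\le q\le m$ and a Levi subalgebra $\mathfrak k$ of $\mathfrak{gl}_{m-q}$ such that $\hat{\mathfrak k}$ is a Lie subsuperalgebra of $W$ and, as Lie superalgebras, $$\hat{\mathfrak k}\;\cong\; W_{q,n}\ltimes(\mathfrak k\otimes A_{q,n}),$$ where $[D,x\otimes f]=x\otimes D(f)$ and $[x\otimes f,y\otimes g]=[x,y]\otimes fg$ for $D\in W_{q,n}$, $x,y\in\mathfrak k$, $f,g\in A_{q,n}$. Here a Levi subalgebra of $\mathfrak{gl}_N$ is a subalgebra $\mathfrak g_0\oplus\bigoplus_{\alpha\in\Delta^0}\mathfrak g_\alpha$ of $\mathfrak g=\mathfrak{gl}_N$, with weight spaces $\mathfrak g_\alpha$ for the diagonal Cartan subalgebra $\mathfrak g_0$, coming from a parabolic decomposition $\Delta(\mathfrak g)=\Delta^+\sqcup\Delta^0\sqcup\Delta^-$ of the roots: with $p$ the projection modulo $\langle\Delta^0\rangle_{\mathbb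 R}$, one has $0\notin p(\Delta^\pm)$, $p(\Delta^+)\cap p(\Delta^-)=\emptyset$, and $p(\Delta^+)\sqcup p(\Delta^-)$ is a triangular decomposition (in the above sense) of $p(\Delta(\mathfrak g)\setminus\Delta^0)$. -/

import Mathlib

open scoped TensorProduct NNReal Matrix

namespace SuperWitt

noncomputable section

/-! ### Superspaces and Lie superalgebras over the complex numbers -/

/-- The sign `(-1)^{ij}` for parities `i`, `j`. -/
def koszul (i j : ZMod 2) : ℂ := if i = 1 ∧ j = 1 then -1 else 1

/-- A superspace: a complex vector space with a `ℤ/2`-grading `V = V_0 ⊕ V_1`. -/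
class SuperSpace (V : Type*) [AddCommGroup V] [Module ℂ V] where
  /-- the homogeneous subspaces -/
  par : ZMod 2 → Submodule ℂ V
  isCompl : IsCompl (par 0) (par 1)


open SuperSpace (par)

section Basics

variable {V V' U : Type*} [AddCommGroup V] [Module ℂ V] [AddCommGroup V'] [Module ℂ V']
  [AddCommGroup U] [Module ℂ U]

@[simp] theorem koszul_zero_left (j : ZMod 2) : koszul 0 j = 1 := by simp [koszul]
@[simp] theorem koszul_zero_right (i : ZMod 2) : koszul i 0 = 1 := by simp [koszul]
@[simp] theorem koszul_one_one : koszul 1 1 = -1 := by simp [koszul]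
@[simp] theorem one_add_one_zmod : (1 : ZMod 2) + 1 = 0 := rfl
theorem zmod_cases (i : ZMod 2) : i = 0 ∨ i = 1 := by revert i; decide

/-- The projection of a superspace to its even part. -/
def evenProj (V : Type*) [AddCommGroup V] [Module ℂ V] [SuperSpace V] : V →ₗ[ℂ] V :=
  (par (V := V) 0).projection (par 1) SuperSpace.isCompl

/-- The projection of a superspace to its odd part. -/
def oddProj (V : Type*) [AddCommGroup V] [Module ℂ V] [SuperSpace V] : V →ₗ[ℂ] V :=
  (par (V := V) 1).projection (par 0) SuperSpace.isCompl.symm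

theorem evenProj_mem [SuperSpace V] (v : V) : evenProj V v ∈ par (V := V) 0 :=
  Submodule.projection_apply_mem _ v

theorem oddProj_mem [SuperSpace V] (v : V) : oddProj V v ∈ par (V := V) 1 :=
  Submodule.projection_apply_mem _ v

theorem even_add_odd [SuperSpace V] (v : V) : evenProj V v + oddProj V v = v :=
  Submodule.projection_add_projection_eq_self _ v

theorem evenProj_even [SuperSpace V] {v : V} (h : v ∈ par (V := V) 0) : evenProj V v = v :=
  Submodule.projection_apply_of_mem_left _ h

theorem evenProj_odd [SuperSpace V] {v : V} (h : v ∈ par (V := V) 1) : evenProj V v = 0 :=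
  Submodule.projection_apply_of_mem_right _ h

theorem oddProj_even [SuperSpace V] {v : V} (h : v ∈ par (V := V) 0) : oddProj V v = 0 :=
  Submodule.projection_apply_of_mem_right _ h

theorem oddProj_odd [SuperSpace V] {v : V} (h : v ∈ par (V := V) 1) : oddProj V v = v :=
  Submodule.projection_apply_of_mem_left _ h

/-- The super-flip of a bilinear map: on homogeneous elements it sends
`(w, v)` to `(-1)^{|v||w|} f v w` (see `superFlip_apply`). -/
def superFlip [SuperSpace V] [SuperSpace V'] (f : V →ₗ[ℂ] V' →ₗ[ℂ] U) :
    V' →ₗ[ℂ] V →ₗ[ℂ] U :=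
  (f ∘ₗ evenProj V).flip + (f ∘ₗ oddProj V).flip ∘ₗ (evenProj V' - oddProj V')

theorem superFlip_apply [SuperSpace V] [SuperSpace V'] (f : V →ₗ[ℂ] V' →ₗ[ℂ] U)
    {i j : ZMod 2} {v : V} {w : V'} (hv : v ∈ par (V := V) i) (hw : w ∈ par (V := V') j) :
    superFlip f w v = koszul i j • f v w := by
  rcases zmod_cases i with rfl | rfl <;> rcases zmod_cases j with rfl | rfl <;>
  simp [superFlip, evenProj_even, evenProj_odd, oddProj_even, oddProj_odd, hv, hw]

end Basics

/-- A Lie superalgebra over `ℂ`. -/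
class LieSuperalgebra (L : Type*) [AddCommGroup L] [Module ℂ L] extends SuperSpace L where
  /-- the bracket `[x, y]` -/
  br : L →ₗ[ℂ] L →ₗ[ℂ] L
  br_mem : ∀ {i j : ZMod 2} {x y : L}, x ∈ par i → y ∈ par j → br x y ∈ par (i + j)
  br_skew : ∀ {i j : ZMod 2} {x y : L}, x ∈ par i → y ∈ par j → br x y = -(koszul i j • br y x)
  br_jacobi : ∀ {i j k : ZMod 2} {x y z : L}, x ∈ par i → y ∈ par j → z ∈ par k →
    br x (br y z) = br (br x y) z + koszul i j • br y (br x z)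

open LieSuperalgebra (br)

/-- Homomorphisms of Lie superalgebras: even linear maps that preserve the bracket. -/
structure LieSuperHom (L L' : Type*) [AddCommGroup L] [Module ℂ L] [LieSuperalgebra L]
    [AddCommGroup L'] [Module ℂ L'] [LieSuperalgebra L'] where
  toLin : L →ₗ[ℂ] L'
  map_par : ∀ {i : ZMod 2} {x : L}, x ∈ par (V := L) i → toLin x ∈ par (V := L') i
  map_br : ∀ x y : L, toLin (br x y) = br (toLin x) (toLin y)

/-- A supercommutative associative unital superalgebra over `ℂ`. -/
class SuperCommAlgebra (A : Type*) [Ring A] [Algebra ℂ A] extends SuperSpace A where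
  one_mem : (1 : A) ∈ par 0
  mul_mem : ∀ {i j : ZMod 2} {a b : A}, a ∈ par i → b ∈ par j → a * b ∈ par (i + j)
  mul_comm : ∀ {i j : ZMod 2} {a b : A}, a ∈ par i → b ∈ par j → a * b = koszul i j • (b * a)

/-! ### Endomorphisms and superderivations -/

section EndSuper

variable {V : Type*} [AddCommGroup V] [Module ℂ V] [SuperSpace V]

/-- Endomorphisms that shift the parity by `i`. -/
def endPar (V : Type*) [AddCommGroup V] [Module ℂ V] [SuperSpace V] (i : ZMod 2) :
    Submodule ℂ (Module.End ℂ V) where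
  carrier := {D | ∀ j : ZMod 2, ∀ v ∈ par (V := V) j, D v ∈ par (V := V) (i + j)}
  add_mem' hD hE j v hv := Submodule.add_mem _ (hD j v hv) (hE j v hv)
  zero_mem' _ _ _ := Submodule.zero_mem _
  smul_mem' c _ hD j v hv := Submodule.smul_mem _ c (hD j v hv)

theorem endPar_isCompl : IsCompl (endPar V 0) (endPar V 1) := by
  constructor
  · rw [Submodule.disjoint_def]
    intro D h0 h1
    have key : ∀ j : ZMod 2, ∀ v ∈ par (V := V) j, D v = 0 := by
      intro j v hv
      have a := h0 j v hv
      have b := h1 j v hv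
      have hd := Submodule.disjoint_def.1 (SuperSpace.isCompl (V := V)).disjoint
      rcases zmod_cases j with rfl | rfl
      · exact hd _ (by simpa using a) (by simpa using b)
      · exact hd _ (by simpa using b) (by simpa using a)
    ext v
    rw [← even_add_odd v, map_add, key 0 _ (evenProj_mem v), key 1 _ (oddProj_mem v)]
    simp
  · rw [codisjoint_iff, eq_top_iff]
    intro D _
    rw [Submodule.mem_sup]
    refine ⟨evenProj V ∘ₗ D ∘ₗ evenProj V + oddProj V ∘ₗ D ∘ₗ oddProj V, ?_,
      oddProj V ∘ₗ D ∘ₗ evenProj V + evenProj V ∘ₗ D ∘ₗ oddProj V, ?_, ?_⟩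
    · intro j v hv
      rcases zmod_cases j with rfl | rfl
      · simpa [evenProj_even hv, oddProj_even hv] using evenProj_mem _
      · simpa [evenProj_odd hv, oddProj_odd hv] using oddProj_mem _
    · intro j v hv
      rcases zmod_cases j with rfl | rfl
      · simpa [evenProj_even hv, oddProj_even hv] using oddProj_mem _
      · simpa [evenProj_odd hv, oddProj_odd hv] using evenProj_mem _
    · ext v
      have h1 := even_add_odd (D (evenProj V v))
      have h2 := even_add_odd (D (oddProj V v))
      have h3 : D v = D (evenProj V v) + D (oddProj V v) := by
        rw [← map_add, even_add_odd]
      simp only [LinearMap.add_apply, LinearMap.comp_apply]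
      rw [h3]
      nth_rewrite 3 [← h1]
      nth_rewrite 3 [← h2]
      abel

instance instSuperSpaceEnd : SuperSpace (Module.End ℂ V) where
  par := endPar V
  isCompl := endPar_isCompl

/-- The supercommutator `DE - (-1)^{|D||E|} ED` on `End V`. -/
def superComm (V : Type*) [AddCommGroup V] [Module ℂ V] [SuperSpace V] :
    Module.End ℂ V →ₗ[ℂ] Module.End ℂ V →ₗ[ℂ] Module.End ℂ V :=
  LinearMap.mul ℂ (Module.End ℂ V) - superFlip (LinearMap.mul ℂ (Module.End ℂ V))

theorem superComm_apply {i j : ZMod 2} {D E : Module.End ℂ V} (hD : D ∈ endPar V i)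
    (hE : E ∈ endPar V j) : superComm V D E = D * E - koszul i j • (E * D) := by
  have h := superFlip_apply (LinearMap.mul ℂ (Module.End ℂ V)) (v := E) (w := D) (i := j)
    (j := i) hE hD
  have hk : koszul j i = koszul i j := by simp [koszul, and_comm]
  simp [superComm, h, hk]

theorem end_mul_mem {i j : ZMod 2} {D E : Module.End ℂ V} (hD : D ∈ endPar V i)
    (hE : E ∈ endPar V j) : D * E ∈ endPar V (i + j) := by
  intro k v hv
  have := hD _ _ (hE k v hv)
  rwa [← add_assoc] at this

theorem superComm_mem {i j : ZMod 2} {D E : Module.End ℂ V} (hD : D ∈ endPar V i)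
    (hE : E ∈ endPar V j) : superComm V D E ∈ endPar V (i + j) := by
  rw [superComm_apply hD hE]
  refine Submodule.sub_mem _ (end_mul_mem hD hE) (Submodule.smul_mem _ _ ?_)
  rw [add_comm]
  exact end_mul_mem hE hD

theorem superComm_skew {i j : ZMod 2} {D E : Module.End ℂ V} (hD : D ∈ endPar V i)
    (hE : E ∈ endPar V j) : superComm V D E = -(koszul i j • superComm V E D) := by
  rw [superComm_apply hD hE, superComm_apply hE hD]
  rcases zmod_cases i with rfl | rfl <;> rcases zmod_cases j with rfl | rfl <;> simp

theorem superComm_jacobi {i j k : ZMod 2} {D E F : Module.End ℂ V} (hD : D ∈ endPar V i)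
    (hE : E ∈ endPar V j) (hF : F ∈ endPar V k) :
    superComm V D (superComm V E F) =
      superComm V (superComm V D E) F + koszul i j • superComm V E (superComm V D F) := by
  rw [superComm_apply hD (superComm_mem hE hF), superComm_apply (superComm_mem hD hE) hF,
    superComm_apply hE (superComm_mem hD hF), superComm_apply hE hF, superComm_apply hD hE,
    superComm_apply hD hF]
  rcases zmod_cases i with rfl | rfl <;> rcases zmod_cases j with rfl | rfl <;>
  rcases zmod_cases k with rfl | rfl <;> simp <;> noncomm_ring

/-- `gl(V)`: the endomorphisms of a superspace with the supercommutator. -/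
instance instLieSuperalgebraEnd : LieSuperalgebra (Module.End ℂ V) where
  br := superComm V
  br_mem := superComm_mem
  br_skew := superComm_skew
  br_jacobi := superComm_jacobi

end EndSuper

section Derivations

variable (A : Type*) [Ring A] [Algebra ℂ A] [SuperSpace A]

/-- Superderivations of parity `i`:
`D (a b) = D(a) b + (-1)^{i |a|} a D(b)`. -/
def derPar (i : ZMod 2) : Submodule ℂ (Module.End ℂ A) where
  carrier := {D | D ∈ endPar A i ∧
    ∀ j : ZMod 2, ∀ a ∈ par (V := A) j, ∀ b : A, D (a * b) = D a * b + koszul i j • (a * D b)}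
  add_mem' := by
    rintro D E ⟨hD, hD'⟩ ⟨hE, hE'⟩
    refine ⟨Submodule.add_mem _ hD hE, fun j a ha b => ?_⟩
    simp only [LinearMap.add_apply, hD' j a ha, hE' j a ha, add_mul, mul_add, smul_add]
    abel
  zero_mem' := ⟨Submodule.zero_mem _, by simp⟩
  smul_mem' := by
    rintro c D ⟨hD, hD'⟩
    refine ⟨Submodule.smul_mem _ _ hD, fun j a ha b => ?_⟩
    simp only [LinearMap.smul_apply, hD' j a ha, smul_add, smul_mul_assoc, mul_smul_comm]
    rw [smul_comm]

/-- The space of superderivations of `A`: sums of an even and an odd superderivation. -/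
def superDerSubmodule : Submodule ℂ (Module.End ℂ A) := derPar A 0 ⊔ derPar A 1

variable {A}

theorem derPar_le (i : ZMod 2) : derPar A i ≤ superDerSubmodule A := by
  rcases zmod_cases i with rfl | rfl
  · exact le_sup_left
  · exact le_sup_right

theorem superComm_der {i j : ZMod 2} {D E : Module.End ℂ A} (hD : D ∈ derPar A i)
    (hE : E ∈ derPar A j) : superComm A D E ∈ derPar A (i + j) := by
  refine ⟨superComm_mem hD.1 hE.1, fun k a ha b => ?_⟩
  rw [superComm_apply hD.1 hE.1]
  simp only [LinearMap.sub_apply, LinearMap.smul_apply, Module.End.mul_apply, hE.2 k a ha,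
    hD.2 k a ha, map_add, map_smul, hD.2 _ _ (hE.1 k a ha), hE.2 _ _ (hD.1 k a ha)]
  rcases zmod_cases i with rfl | rfl <;> rcases zmod_cases j with rfl | rfl <;>
  rcases zmod_cases k with rfl | rfl <;> simp <;> noncomm_ring

theorem superComm_superDer {D E : Module.End ℂ A} (hD : D ∈ superDerSubmodule A)
    (hE : E ∈ superDerSubmodule A) :
    superComm A D E ∈ superDerSubmodule A := by
  obtain ⟨D0, hD0, D1, hD1, rfl⟩ := Submodule.mem_sup.1 hD
  obtain ⟨E0, hE0, E1, hE1, rfl⟩ := Submodule.mem_sup.1 hE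
  simp only [map_add, LinearMap.add_apply]
  exact Submodule.add_mem _
    (Submodule.add_mem _ (derPar_le _ (superComm_der hD0 hE0)) (derPar_le _ (superComm_der hD1 hE0)))
    (Submodule.add_mem _ (derPar_le _ (superComm_der hD0 hE1)) (derPar_le _ (superComm_der hD1 hE1)))

theorem superDer_isCompl : IsCompl ((derPar A 0).comap (superDerSubmodule A).subtype)
    ((derPar A 1).comap (superDerSubmodule A).subtype) := by
  constructor
  · rw [Submodule.disjoint_def]
    intro D h0 h1
    exact Subtype.ext (Submodule.disjoint_def.1 (endPar_isCompl (V := A)).disjoint _ h0.1 h1.1)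
  · rw [codisjoint_iff, eq_top_iff]
    rintro ⟨D, hD⟩ _
    obtain ⟨D0, h0, D1, h1, rfl⟩ := Submodule.mem_sup.1 hD
    exact Submodule.mem_sup.2
      ⟨⟨D0, derPar_le 0 h0⟩, h0, ⟨D1, derPar_le 1 h1⟩, h1, rfl⟩

/-- The supercommutator of superderivations. -/
def derBr : superDerSubmodule A →ₗ[ℂ] superDerSubmodule A →ₗ[ℂ] superDerSubmodule A :=
  LinearMap.mk₂ ℂ
    (fun D E => ⟨superComm A D E, superComm_superDer D.2 E.2⟩)
    (by intros; ext1; simp) (by intros; ext1; simp) (by intros; ext1; simp)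
    (by intros; ext1; simp)

variable (A) in
/-- The type of superderivations of `A`. -/
def SuperDer : Type _ := superDerSubmodule A

instance : AddCommGroup (SuperDer A) := inferInstanceAs (AddCommGroup (superDerSubmodule A))

instance : Module ℂ (SuperDer A) := inferInstanceAs (Module ℂ (superDerSubmodule A))

variable (A) in
/-- The inclusion of the superderivations into `End A`. -/
def derToEnd : SuperDer A →ₗ[ℂ] Module.End ℂ A := (superDerSubmodule A).subtype

/-- The Lie superalgebra of superderivations, with the supercommutator. -/
instance instLieSuperalgebraSuperDer : LieSuperalgebra (SuperDer A) where
  par i := (derPar A i).comap (derToEnd A)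
  isCompl := superDer_isCompl
  br := derBr
  br_mem hD hE := superComm_der hD hE
  br_skew hD hE := Subtype.ext (superComm_skew hD.1 hE.1)
  br_jacobi hD hE hF := Subtype.ext (superComm_jacobi hD.1 hE.1 hF.1)

theorem derToEnd_br (D E : SuperDer A) :
    derToEnd A (br D E) = superComm A (derToEnd A D) (derToEnd A E) := rfl

end Derivations

/-! ### Tensor products with a purely even factor -/

section Tensor

variable {V B : Type*} [AddCommGroup V] [Module ℂ V]

theorem tensor_isCompl [AddCommGroup B] [Module ℂ B] [SuperSpace B] :
    IsCompl (LinearMap.range (LinearMap.lTensor V (par (V := B) 0).subtype))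
      (LinearMap.range (LinearMap.lTensor V (par (V := B) 1).subtype)) := by
  constructor
  · rw [Submodule.disjoint_def]
    rintro x ⟨y, rfl⟩ ⟨z, hz⟩
    have e : oddProj B ∘ₗ (par (V := B) 0).subtype = 0 := by
      ext b; simp [oddProj_even b.2]
    have o : oddProj B ∘ₗ (par (V := B) 1).subtype = (par (V := B) 1).subtype := by
      ext b; simp [oddProj_odd b.2]
    have h := congrArg (LinearMap.lTensor V (oddProj B)) hz
    rw [← LinearMap.comp_apply, ← LinearMap.comp_apply, ← LinearMap.lTensor_comp,
      ← LinearMap.lTensor_comp, e, o, LinearMap.lTensor_zero, hz] at h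
    simpa using h
  · rw [codisjoint_iff, eq_top_iff]
    intro x _
    induction x with
    | zero => exact Submodule.zero_mem _
    | add x y hx hy => exact Submodule.add_mem _ (hx trivial) (hy trivial)
    | tmul v b =>
      rw [← even_add_odd b, TensorProduct.tmul_add]
      exact Submodule.add_mem_sup ⟨v ⊗ₜ ⟨_, evenProj_mem b⟩, by simp⟩
        ⟨v ⊗ₜ ⟨_, oddProj_mem b⟩, by simp⟩

/-- `V ⊗ B` for a purely even vector space `V` and a superspace `B`:
`(V ⊗ B)_i = V ⊗ B_i`. -/
instance instSuperSpaceTensor [AddCommGroup B] [Module ℂ B] [SuperSpace B] :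
    SuperSpace (V ⊗[ℂ] B) where
  par i := LinearMap.range (LinearMap.lTensor V (par (V := B) i).subtype)
  isCompl := tensor_isCompl

theorem tmul_mem_par [AddCommGroup B] [Module ℂ B] [SuperSpace B] (v : V) {i : ZMod 2} {b : B}
    (hb : b ∈ par (V := B) i) : v ⊗ₜ[ℂ] b ∈ par (V := V ⊗[ℂ] B) i :=
  ⟨v ⊗ₜ ⟨b, hb⟩, by simp⟩

theorem tensor_par_induction [AddCommGroup B] [Module ℂ B] [SuperSpace B] {i : ZMod 2}
    {p : ∀ x : V ⊗[ℂ] B, x ∈ par (V := V ⊗[ℂ] B) i → Prop}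
    (zero : p 0 (Submodule.zero_mem _))
    (add : ∀ x y hx hy, p x hx → p y hy → p (x + y) (Submodule.add_mem _ hx hy))
    (tmul : ∀ (v : V) (b : B) (hb : b ∈ par (V := B) i), p (v ⊗ₜ b) (tmul_mem_par v hb))
    (x : V ⊗[ℂ] B) (hx : x ∈ par (V := V ⊗[ℂ] B) i) : p x hx := by
  obtain ⟨y, rfl⟩ := hx
  induction y with
  | zero => simpa using zero
  | add x y hx hy => simpa only [map_add] using add _ _ _ _ hx hy
  | tmul v b => simpa using tmul v b b.2

/-- `R ⊗ B` is supercommutative if `R` is commutative and `B` is supercommutative. -/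
instance instSuperCommAlgebraTensor {R : Type*} [CommRing R] [Algebra ℂ R] [Ring B] [Algebra ℂ B]
    [SuperCommAlgebra B] : SuperCommAlgebra (R ⊗[ℂ] B) where
  one_mem := tmul_mem_par (1 : R) SuperCommAlgebra.one_mem
  mul_mem := by
    intro i j a b ha hb
    induction a, ha using tensor_par_induction with
    | zero => simp
    | add x y _ _ hx hy => rw [add_mul]; exact Submodule.add_mem _ hx hy
    | tmul r u hu =>
      induction b, hb using tensor_par_induction with
      | zero => simp
      | add x y _ _ hx hy => rw [mul_add]; exact Submodule.add_mem _ hx hy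
      | tmul s w hw =>
        rw [Algebra.TensorProduct.tmul_mul_tmul]
        exact tmul_mem_par _ (SuperCommAlgebra.mul_mem hu hw)
  mul_comm := by
    intro i j a b ha hb
    induction a, ha using tensor_par_induction with
    | zero => simp
    | add x y _ _ hx hy => rw [add_mul, hx, hy, mul_add, smul_add]
    | tmul r u hu =>
      induction b, hb using tensor_par_induction with
      | zero => simp
      | add x y _ _ hx hy => rw [mul_add, hx, hy, add_mul, smul_add]
      | tmul s w hw =>
        rw [Algebra.TensorProduct.tmul_mul_tmul, Algebra.TensorProduct.tmul_mul_tmul,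
          SuperCommAlgebra.mul_comm hu hw, TensorProduct.tmul_smul, mul_comm r s]

end Tensor

section Current

variable {K A : Type*} [LieRing K] [LieAlgebra ℂ K] [Ring A] [Algebra ℂ A]

/-- The bracket `[x ⊗ f, y ⊗ g] = [x, y] ⊗ f g` on `K ⊗ A`. -/
def currentBr (K A : Type*) [LieRing K] [LieAlgebra ℂ K] [Ring A] [Algebra ℂ A] :
    K ⊗[ℂ] A →ₗ[ℂ] K ⊗[ℂ] A →ₗ[ℂ] K ⊗[ℂ] A :=
  TensorProduct.map₂ (LieAlgebra.ad ℂ K : K →ₗ[ℂ] Module.End ℂ K) (LinearMap.mul ℂ A)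

@[simp] theorem currentBr_tmul (x y : K) (f g : A) :
    currentBr K A (x ⊗ₜ f) (y ⊗ₜ g) = ⁅x, y⁆ ⊗ₜ (f * g) := by
  simp [currentBr]

/-- The Lie superalgebra `K ⊗ A` for a Lie algebra `K` and a supercommutative algebra `A`. -/
instance instLieSuperalgebraCurrent [SuperCommAlgebra A] : LieSuperalgebra (K ⊗[ℂ] A) where
  br := currentBr K A
  br_mem := by
    intro i j a b ha hb
    induction a, ha using tensor_par_induction with
    | zero => simp
    | add x y _ _ hx hy => rw [map_add]; exact Submodule.add_mem _ hx hy
    | tmul r u hu =>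
      induction b, hb using tensor_par_induction with
      | zero => simp
      | add x y _ _ hx hy => rw [map_add]; exact Submodule.add_mem _ hx hy
      | tmul s w hw =>
        rw [currentBr_tmul]
        exact tmul_mem_par _ (SuperCommAlgebra.mul_mem hu hw)
  br_skew := by
    intro i j a b ha hb
    induction a, ha using tensor_par_induction with
    | zero => simp
    | add x y _ _ hx hy => rw [map_add, map_add, LinearMap.add_apply, hx, hy, smul_add, neg_add]
    | tmul r u hu =>
      induction b, hb using tensor_par_induction with
      | zero => simp
      | add x y _ _ hx hy => rw [map_add, map_add, LinearMap.add_apply, hx, hy, smul_add, neg_add]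
      | tmul s w hw =>
        rw [currentBr_tmul, currentBr_tmul, SuperCommAlgebra.mul_comm hu hw,
          TensorProduct.tmul_smul, ← lie_skew, TensorProduct.neg_tmul, smul_neg]
  br_jacobi := by
    intro i j k a b c ha hb hc
    induction a, ha using tensor_par_induction with
    | zero => simp
    | add x y _ _ hx hy =>
      simp only [map_add, LinearMap.add_apply, hx, hy, smul_add]; abel
    | tmul r u hu =>
      induction b, hb using tensor_par_induction with
      | zero => simp
      | add x y _ _ hx hy =>
        simp only [map_add, LinearMap.add_apply, hx, hy, smul_add]; abel
      | tmul s w hw =>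
        induction c, hc using tensor_par_induction with
        | zero => simp
        | add x y _ _ hx hy =>
          simp only [map_add, hx, hy, smul_add]; abel
        | tmul t z hz =>
          simp only [currentBr_tmul]
          rw [← TensorProduct.tmul_smul, ← mul_assoc w u z, ← smul_mul_assoc,
            ← SuperCommAlgebra.mul_comm hu hw, leibniz_lie, TensorProduct.add_tmul, mul_assoc]

end Current

/-! ### Semidirect products -/

/-- An action of a Lie superalgebra `G` on a Lie superalgebra `H` by superderivations. -/
structure SuperAction (G H : Type*) [AddCommGroup G] [Module ℂ G] [LieSuperalgebra G]
    [AddCommGroup H] [Module ℂ H] [LieSuperalgebra H] extends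
    LieSuperHom G (Module.End ℂ H) where
  leibniz : ∀ {i j : ZMod 2} {D : G} {u : H}, D ∈ par (V := G) i → u ∈ par (V := H) j → ∀ v : H,
    toLin D (br u v) = br (toLin D u) v + koszul i j • br u (toLin D v)

section Semidirect

variable {G H : Type*} [AddCommGroup G] [Module ℂ G] [LieSuperalgebra G]
    [AddCommGroup H] [Module ℂ H] [LieSuperalgebra H]

/-- The vector space `G ⊕ H` underlying the semidirect product `G ⋉ H`. -/
def Semidirect (_φ : SuperAction G H) : Type _ := G × H

instance (φ : SuperAction G H) : AddCommGroup (Semidirect φ) :=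
  inferInstanceAs (AddCommGroup (G × H))

instance (φ : SuperAction G H) : Module ℂ (Semidirect φ) :=
  inferInstanceAs (Module ℂ (G × H))

/-- The bracket `[(D, u), (E, v)] = ([D, E], D·v - (-1)^{|E||u|} E·u + [u, v])`. -/
def semidirectBr (φ : SuperAction G H) :
    (G × H) →ₗ[ℂ] (G × H) →ₗ[ℂ] (G × H) :=
  LinearMap.mk₂ ℂ (fun x y => (br x.1 y.1,
      φ.toLin x.1 y.2 - superFlip φ.toLin x.2 y.1 + br x.2 y.2))
    (by intros; ext <;> simp; abel)
    (by intros; ext <;> simp [smul_add, smul_sub])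
    (by intros; ext <;> simp; abel)
    (by intros; ext <;> simp [smul_add, smul_sub])

theorem semidirectBr_fst (φ : SuperAction G H) (x y : G × H) :
    (semidirectBr φ x y).1 = br x.1 y.1 := rfl

theorem semidirectBr_snd (φ : SuperAction G H) {i j : ZMod 2} {x y : G × H}
    (hx : x.2 ∈ par (V := H) i) (hy : y.1 ∈ par (V := G) j) :
    (semidirectBr φ x y).2 =
      φ.toLin x.1 y.2 - koszul j i • φ.toLin y.1 x.2 + br x.2 y.2 := by
  rw [← superFlip_apply φ.toLin hy hx]; rfl

theorem action_mem (φ : SuperAction G H) {i j : ZMod 2} {D : G} {u : H}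
    (hD : D ∈ par (V := G) i) (hu : u ∈ par (V := H) j) : φ.toLin D u ∈ par (V := H) (i + j) :=
  φ.map_par hD j u hu

theorem action_br (φ : SuperAction G H) {i j : ZMod 2} {D E : G}
    (hD : D ∈ par (V := G) i) (hE : E ∈ par (V := G) j) (u : H) :
    φ.toLin (br D E) u = φ.toLin D (φ.toLin E u) - koszul i j • φ.toLin E (φ.toLin D u) := by
  rw [φ.map_br]
  exact congrArg (fun f => f u) (superComm_apply (φ.map_par hD) (φ.map_par hE))

theorem semidirectBr_mem (φ : SuperAction G H) {i j : ZMod 2} {x y : G × H}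
    (hx : x ∈ (par (V := G) i).prod (par (V := H) i))
    (hy : y ∈ (par (V := G) j).prod (par (V := H) j)) :
    semidirectBr φ x y ∈ (par (V := G) (i + j)).prod (par (V := H) (i + j)) := by
  refine ⟨LieSuperalgebra.br_mem hx.1 hy.1, ?_⟩
  rw [semidirectBr_snd φ hx.2 hy.1]
  refine Submodule.add_mem _ (Submodule.sub_mem _ (action_mem φ hx.1 hy.2)
    (Submodule.smul_mem _ _ ?_)) (LieSuperalgebra.br_mem hx.2 hy.2)
  rw [add_comm]
  exact action_mem φ hy.1 hx.2

theorem prod_isCompl : IsCompl ((par (V := G) 0).prod (par (V := H) 0))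
    ((par (V := G) 1).prod (par (V := H) 1)) := by
  constructor
  · rw [Submodule.disjoint_def]
    intro x h0 h1
    exact Prod.ext (Submodule.disjoint_def.1 (SuperSpace.isCompl (V := G)).disjoint _ h0.1 h1.1)
      (Submodule.disjoint_def.1 (SuperSpace.isCompl (V := H)).disjoint _ h0.2 h1.2)
  · rw [codisjoint_iff, eq_top_iff]
    intro x _
    exact Submodule.mem_sup.2
      ⟨(evenProj G x.1, evenProj H x.2), ⟨evenProj_mem _, evenProj_mem _⟩,
        (oddProj G x.1, oddProj H x.2), ⟨oddProj_mem _, oddProj_mem _⟩,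
        Prod.ext (even_add_odd _) (even_add_odd _)⟩

theorem semidirectBr_skew (φ : SuperAction G H) {i j : ZMod 2} {x y : G × H}
    (hx : x ∈ (par (V := G) i).prod (par (V := H) i))
    (hy : y ∈ (par (V := G) j).prod (par (V := H) j)) :
    semidirectBr φ x y = -(koszul i j • semidirectBr φ y x) := by
  refine Prod.ext (LieSuperalgebra.br_skew hx.1 hy.1) ?_
  have h := LieSuperalgebra.br_skew hx.2 hy.2
  rw [Prod.snd_neg, Prod.smul_snd, semidirectBr_snd φ hx.2 hy.1, semidirectBr_snd φ hy.2 hx.1, h]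
  rcases zmod_cases i with rfl | rfl <;> rcases zmod_cases j with rfl | rfl <;> simp <;>
  abel

theorem semidirectBr_jacobi (φ : SuperAction G H) {i j k : ZMod 2} {x y z : G × H}
    (hx : x ∈ (par (V := G) i).prod (par (V := H) i))
    (hy : y ∈ (par (V := G) j).prod (par (V := H) j))
    (hz : z ∈ (par (V := G) k).prod (par (V := H) k)) :
    semidirectBr φ x (semidirectBr φ y z) =
      semidirectBr φ (semidirectBr φ x y) z +
        koszul i j • semidirectBr φ y (semidirectBr φ x z) := by
  refine Prod.ext (LieSuperalgebra.br_jacobi hx.1 hy.1 hz.1) ?_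
  have hyz := semidirectBr_mem φ hy hz
  have hxy := semidirectBr_mem φ hx hy
  have hxz := semidirectBr_mem φ hx hz
  rw [Prod.snd_add, Prod.smul_snd, semidirectBr_snd φ hx.2 hyz.1, semidirectBr_snd φ hxy.2 hz.1,
    semidirectBr_snd φ hy.2 hxz.1]
  simp only [semidirectBr_fst]
  rw [semidirectBr_snd φ hx.2 hy.1, semidirectBr_snd φ hy.2 hz.1,
    semidirectBr_snd φ hx.2 hz.1]
  have s1 := LieSuperalgebra.br_skew (action_mem φ hz.1 hx.2) hy.2
  simp only [map_add, map_sub, map_smul, LinearMap.add_apply, LinearMap.sub_apply,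
    LinearMap.smul_apply, action_br φ hx.1 hy.1, action_br φ hy.1 hz.1, action_br φ hx.1 hz.1,
    φ.leibniz hx.1 hy.2, φ.leibniz hy.1 hx.2, φ.leibniz hz.1 hx.2,
    LieSuperalgebra.br_jacobi hx.2 hy.2 hz.2, smul_add, smul_sub]
  rcases zmod_cases i with rfl | rfl <;> rcases zmod_cases j with rfl | rfl <;>
  rcases zmod_cases k with rfl | rfl <;> simp at s1 ⊢ <;> rw [s1] <;>
  abel

/-- The semidirect product `G ⋉ H` of Lie superalgebras. -/
instance instLieSuperalgebraSemidirect (φ : SuperAction G H) :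
    LieSuperalgebra (Semidirect φ) where
  par i := (par (V := G) i).prod (par (V := H) i)
  isCompl := prod_isCompl
  br := semidirectBr φ
  br_mem := semidirectBr_mem φ
  br_skew := semidirectBr_skew φ
  br_jacobi := semidirectBr_jacobi φ

end Semidirect

/-! ### The action of superderivations on current algebras -/

/-- A linear map preserving parities that respects brackets of homogeneous elements is a
homomorphism of Lie superalgebras. -/
theorem map_br_of_homogeneous {L L' : Type*} [AddCommGroup L] [Module ℂ L] [LieSuperalgebra L]
    [AddCommGroup L'] [Module ℂ L'] [LieSuperalgebra L'] (f : L →ₗ[ℂ] L')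
    (h : ∀ (i j : ZMod 2) (x y : L), x ∈ par (V := L) i → y ∈ par (V := L) j →
      f (br x y) = br (f x) (f y)) (x y : L) : f (br x y) = br (f x) (f y) := by
  rw [← even_add_odd x, ← even_add_odd y]
  simp only [map_add, LinearMap.add_apply, h 0 0 _ _ (evenProj_mem x) (evenProj_mem y),
    h 0 1 _ _ (evenProj_mem x) (oddProj_mem y), h 1 0 _ _ (oddProj_mem x) (evenProj_mem y),
    h 1 1 _ _ (oddProj_mem x) (oddProj_mem y)]

section CurrentAction

variable (K A : Type*) [LieRing K] [LieAlgebra ℂ K] [Ring A] [Algebra ℂ A] [SuperCommAlgebra A]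

theorem lTensor_par {i : ZMod 2} {D : Module.End ℂ A} (hD : D ∈ endPar A i) :
    (LinearMap.lTensor K D : Module.End ℂ (K ⊗[ℂ] A)) ∈ endPar (K ⊗[ℂ] A) i := by
  intro j v hv
  induction v, hv using tensor_par_induction with
  | zero => simp
  | add x y _ _ hx hy => rw [map_add]; exact Submodule.add_mem _ hx hy
  | tmul x f hf => exact tmul_mem_par _ (hD j f hf)

/-- The action `D · (x ⊗ f) = x ⊗ D(f)` of the superderivations of `A` on `K ⊗ A`. -/
def currentAction : SuperAction (SuperDer A) (K ⊗[ℂ] A) where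
  toLin := LinearMap.lTensorHom K ∘ₗ derToEnd A
  map_par h := lTensor_par K A h.1
  map_br := map_br_of_homogeneous (L := SuperDer A) _ <| by
    intro i j D E hD hE
    have hD' : derToEnd A D ∈ endPar A i := And.left hD
    have hE' : derToEnd A E ∈ endPar A j := And.left hE
    refine Eq.trans ?_ (superComm_apply (lTensor_par K A hD') (lTensor_par K A hE')).symm
    change LinearMap.lTensor K (derToEnd A (br D E)) = _
    rw [derToEnd_br, superComm_apply hD' hE', LinearMap.lTensor_sub, LinearMap.lTensor_smul,
      LinearMap.lTensor_mul, LinearMap.lTensor_mul]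
  leibniz := by
    intro i j D u hD hu v
    change LinearMap.lTensor K (derToEnd A D) (currentBr K A u v) =
      currentBr K A (LinearMap.lTensor K (derToEnd A D) u) v +
        koszul i j • currentBr K A u (LinearMap.lTensor K (derToEnd A D) v)
    induction u, hu using tensor_par_induction with
    | zero => simp
    | add x y _ _ hx hy => simp only [map_add, LinearMap.add_apply, hx, hy, smul_add]; abel
    | tmul x f hf =>
      induction v with
      | zero => simp
      | add v w hv hw => simp only [map_add, hv, hw, smul_add]; abel
      | tmul y g =>
        have h : derToEnd A D (f * g) = derToEnd A D f * g + koszul i j • (f * derToEnd A D g) :=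
          hD.2 j f hf g
        simp only [currentBr_tmul, LinearMap.lTensor_tmul]
        rw [h, TensorProduct.tmul_add, TensorProduct.tmul_smul]

end CurrentAction

/-! ### The superalgebra `A_{m,n}` and the Lie superalgebra `W_{m,n}` -/

section Exterior

variable (U : Type*) [AddCommGroup U] [Module ℂ U]

theorem ι_mul_eq (u : U) (x : ExteriorAlgebra ℂ U) :
    ExteriorAlgebra.ι ℂ u * x = CliffordAlgebra.involute x * ExteriorAlgebra.ι ℂ u := by
  induction x using ExteriorAlgebra.induction with
  | algebraMap r => rw [AlgHom.commutes, Algebra.commutes]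
  | ι v =>
    have h := CliffordAlgebra.involute_ι (Q := (0 : QuadraticForm ℂ U)) v
    have h2 := ExteriorAlgebra.ι_add_mul_swap (R := ℂ) u v
    rw [show CliffordAlgebra.involute (ExteriorAlgebra.ι ℂ v) = -ExteriorAlgebra.ι ℂ v from h,
      neg_mul]
    exact eq_neg_of_add_eq_zero_left h2
  | mul a b ha hb => rw [← mul_assoc, ha, mul_assoc, hb, map_mul, mul_assoc]
  | add a b ha hb => rw [mul_add, ha, hb, map_add, add_mul]

/-- The exterior algebra with its `ℤ/2`-grading. -/
instance instSuperCommAlgebraExterior : SuperCommAlgebra (ExteriorAlgebra ℂ U) where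
  par := CliffordAlgebra.evenOdd 0
  isCompl := CliffordAlgebra.evenOdd_isCompl 0
  one_mem := SetLike.GradedOne.one_mem
  mul_mem ha hb := SetLike.mul_mem_graded ha hb
  mul_comm := by
    intro i j a b ha hb
    have key : ∀ u, ExteriorAlgebra.ι ℂ u * b = koszul 1 j • (b * ExteriorAlgebra.ι ℂ u) := by
      intro u
      rw [ι_mul_eq]
      rcases zmod_cases j with rfl | rfl
      · simp [CliffordAlgebra.involute_eq_of_mem_even hb]
      · simp [CliffordAlgebra.involute_eq_of_mem_odd hb]
    have key2 : ∀ (u v : U) (x : ExteriorAlgebra ℂ U) (c : ℂ), x * b = c • (b * x) →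
        ExteriorAlgebra.ι ℂ u * ExteriorAlgebra.ι ℂ v * x * b =
          c • (b * (ExteriorAlgebra.ι ℂ u * ExteriorAlgebra.ι ℂ v * x)) := by
      intro u v x c hx
      rw [mul_assoc, hx, mul_smul_comm, ← mul_assoc, mul_assoc (ExteriorAlgebra.ι ℂ u), key v,
        mul_smul_comm, ← mul_assoc (ExteriorAlgebra.ι ℂ u) b, key u]
      have hk : koszul 1 j * koszul 1 j = 1 := by
        rcases zmod_cases j with rfl | rfl <;> simp
      simp only [smul_mul_assoc, smul_smul, hk, mul_one, mul_assoc b]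
    rcases zmod_cases i with rfl | rfl
    · induction a, ha using CliffordAlgebra.even_induction with
      | algebraMap r => simp [Algebra.commutes]
      | add x y _ _ hx hy => rw [add_mul, hx, hy, mul_add, smul_add]
      | ι_mul_ι_mul u v x _ hx => exact key2 u v x _ hx
    · induction a, ha using CliffordAlgebra.odd_induction with
      | ι v => exact key v
      | add x y _ _ hx hy => rw [add_mul, hx, hy, mul_add, smul_add]
      | ι_mul_ι_mul u v x _ hx => exact key2 u v x _ hx

end Exterior

/-- The superalgebra `A_{m,n} = ℂ[t_1, …, t_m] ⊗ Λ(ξ_1, …, ξ_n)`. -/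
def PolyExt (m n : ℕ) : Type :=
  MvPolynomial (Fin m) ℂ ⊗[ℂ] ExteriorAlgebra ℂ (Fin n → ℂ)

instance (m n : ℕ) : Ring (PolyExt m n) :=
  inferInstanceAs (Ring (MvPolynomial (Fin m) ℂ ⊗[ℂ] ExteriorAlgebra ℂ (Fin n → ℂ)))

instance (m n : ℕ) : Algebra ℂ (PolyExt m n) :=
  inferInstanceAs (Algebra ℂ (MvPolynomial (Fin m) ℂ ⊗[ℂ] ExteriorAlgebra ℂ (Fin n → ℂ)))

instance (m n : ℕ) : SuperCommAlgebra (PolyExt m n) :=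
  inferInstanceAs
    (SuperCommAlgebra (MvPolynomial (Fin m) ℂ ⊗[ℂ] ExteriorAlgebra ℂ (Fin n → ℂ)))

/-- The Lie superalgebra `W_{m,n}` of superderivations of `A_{m,n}`. -/
abbrev W (m n : ℕ) : Type := SuperDer (PolyExt m n)

/-- The derivation `t_i ∂/∂t_i` of the polynomial ring. -/
def polyEuler (m : ℕ) (i : Fin m) :
    Derivation ℂ (MvPolynomial (Fin m) ℂ) (MvPolynomial (Fin m) ℂ) :=
  (MvPolynomial.X i : MvPolynomial (Fin m) ℂ) • MvPolynomial.pderiv i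

/-- The operator `t_i ∂/∂t_i` on `A_{m,n}`. -/
def eulerOp (m n : ℕ) (i : Fin m) : Module.End ℂ (PolyExt m n) :=
  (LinearMap.rTensor (ExteriorAlgebra ℂ (Fin n → ℂ)) (polyEuler m i).toLinearMap :
    MvPolynomial (Fin m) ℂ ⊗[ℂ] ExteriorAlgebra ℂ (Fin n → ℂ) →ₗ[ℂ]
      MvPolynomial (Fin m) ℂ ⊗[ℂ] ExteriorAlgebra ℂ (Fin n → ℂ))

theorem rTensor_mul {R B : Type*} [CommRing R] [Algebra ℂ R] [Ring B] [Algebra ℂ B]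
    (d : Derivation ℂ R R) (a b : R ⊗[ℂ] B) :
    LinearMap.rTensor B d.toLinearMap (a * b) =
      LinearMap.rTensor B d.toLinearMap a * b + a * LinearMap.rTensor B d.toLinearMap b := by
  induction a with
  | zero => simp
  | add x y hx hy => simp only [add_mul, map_add, hx, hy]; abel
  | tmul p e =>
    induction b with
    | zero => simp
    | add x y hx hy => simp only [mul_add, map_add, hx, hy]; abel
    | tmul p' e' =>
      simp only [Algebra.TensorProduct.tmul_mul_tmul, LinearMap.rTensor_tmul,
        Derivation.coeFn_coe, Derivation.leibniz, smul_eq_mul,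
        TensorProduct.add_tmul]
      rw [add_comm, mul_comm p' _]

theorem rTensor_par {V B : Type*} [AddCommGroup V] [Module ℂ V] [AddCommGroup B] [Module ℂ B]
    [SuperSpace B] (f : V →ₗ[ℂ] V) {j : ZMod 2} {v : V ⊗[ℂ] B}
    (hv : v ∈ par (V := V ⊗[ℂ] B) j) : LinearMap.rTensor B f v ∈ par (V := V ⊗[ℂ] B) j := by
  induction v, hv using tensor_par_induction with
  | zero => simp
  | add x y _ _ hx hy => rw [map_add]; exact Submodule.add_mem _ hx hy
  | tmul x b hb => exact tmul_mem_par _ hb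

theorem eulerOp_mem (m n : ℕ) (i : Fin m) : eulerOp m n i ∈ derPar (PolyExt m n) 0 := by
  constructor
  · intro j v hv
    rw [zero_add]
    exact rTensor_par _ hv
  · intro j a _ b
    rw [koszul_zero_left, one_smul]
    exact rTensor_mul (polyEuler m i) a b

/-- The element `d_i = t_i ∂/∂t_i` of `W_{m,n}`; `d_1, …, d_m` span the Cartan subalgebra `𝔥`. -/
def euler (m n : ℕ) (i : Fin m) : W m n := ⟨eulerOp m n i, derPar_le 0 (eulerOp_mem m n i)⟩

/-! ### Weights -/

section Weights

variable {m : ℕ} {V : Type*} [AddCommGroup V] [Module ℂ V]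

/-- Let `d_1, …, d_m` be a basis of a Cartan subalgebra `𝔥` acting on `V` by `T_1, …, T_m`. A weight
`α = ∑ α_i ε_i ∈ 𝔥^*`, where `ε_1, …, ε_m` is the dual basis, is identified with `(α_1, …, α_m)`;
this is the weight space `V_α`. -/
def wtSpace (T : Fin m → Module.End ℂ V) (α : Fin m → ℂ) : Submodule ℂ V :=
  ⨅ i, Module.End.eigenspace (T i) (α i)

/-- The support: the set of weights with nonzero weight space. -/
def support (T : Fin m → Module.End ℂ V) : Set (Fin m → ℂ) := {α | wtSpace T α ≠ ⊥}

/-- The root set `Δ(𝔤)`, where `T` is the adjoint action of `𝔥` on `𝔤`. -/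
def roots (T : Fin m → Module.End ℂ V) : Set (Fin m → ℂ) := support T \ {0}

/-- The subspace `𝔤_0 ⊕ ⨁_{α ∈ Z} 𝔤_α` of `𝔤`, where `𝔤_0` is the centralizer of `𝔥` and
`T` the adjoint action of `𝔥` on `𝔤`. For a parabolic decomposition of `Δ(𝔤)` with
zero part `Z` and positive part `P`, this is the Levi subalgebra `𝔤^0` of the parabolic
subalgebra `𝔤^0 ⊕ ⨁_{α ∈ P} 𝔤_α`. -/
def leviSpace (T : Fin m → Module.End ℂ V) (Z : Set (Fin m → ℂ)) : Submodule ℂ V :=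
  wtSpace T 0 ⊔ ⨆ α ∈ Z, wtSpace T α

end Weights

/-! ### Triangular and parabolic decompositions -/

section Decompositions

variable {E : Type*} [AddCommGroup E] [Module ℝ E]

/-- `D = P ⊔ N` is a triangular decomposition:
`⟨-P ∪ N⟩_{ℝ₊} ∩ ⟨-N ∪ P⟩_{ℝ₊} = {0}`. -/
structure IsTriangularDecomp (D P N : Set E) : Prop where
  union : P ∪ N = D
  disjoint : Disjoint P N
  cone : Submodule.span ℝ≥0 ({x | -x ∈ P} ∪ N) ⊓ Submodule.span ℝ≥0 ({x | -x ∈ N} ∪ P) = ⊥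

/-- `D = P ⊔ Z ⊔ N` is a parabolic decomposition, with `p` the projection modulo the real
span of `Z`. -/
structure IsParabolicDecomp (D P Z N : Set E) : Prop where
  union : P ∪ Z ∪ N = D
  disjoint_pos_zero : Disjoint P Z
  disjoint_pos_neg : Disjoint P N
  disjoint_zero_neg : Disjoint Z N
  zero_notMem_pos : (0 : E ⧸ Submodule.span ℝ Z) ∉ (Submodule.span ℝ Z).mkQ '' P
  zero_notMem_neg : (0 : E ⧸ Submodule.span ℝ Z) ∉ (Submodule.span ℝ Z).mkQ '' N
  triangular : IsTriangularDecomp ((Submodule.span ℝ Z).mkQ '' (D \ Z))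
    ((Submodule.span ℝ Z).mkQ '' P) ((Submodule.span ℝ Z).mkQ '' N)

end Decompositions

attribute [local instance] LieRing.ofAssociativeRing

/-- The Lie subalgebras of `𝔤𝔩_N`. -/
abbrev GlSubalgebra (N : ℕ) : Type := LieSubalgebra ℂ (Matrix (Fin N) (Fin N) ℂ)

/-- The adjoint action of the diagonal matrix units on `𝔤𝔩_N`. -/
def glCartan (N : ℕ) (i : Fin N) : Module.End ℂ (Matrix (Fin N) (Fin N) ℂ) :=
  LieAlgebra.ad ℂ (Matrix (Fin N) (Fin N) ℂ) (Matrix.single i i 1)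

/-- `𝔨` is a Levi subalgebra of `𝔤𝔩_N`: the subalgebra `𝔤^0` for a parabolic decomposition of the
roots of `𝔤𝔩_N` with respect to the diagonal Cartan subalgebra. -/
def IsLeviOfGl {N : ℕ} (k : GlSubalgebra N) : Prop :=
  ∃ P Z Ng : Set (Fin N → ℂ), IsParabolicDecomp (roots (glCartan N)) P Z Ng ∧
    k.toSubmodule = leviSpace (glCartan N) Z

/-! ### Weight modules over `W_{m,n}` -/

/-- The adjoint action of `d_i` on `W_{m,n}`. -/
def adEuler (m n : ℕ) (i : Fin m) : Module.End ℂ (W m n) := br (euler m n i)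

section Modules

variable {m n : ℕ} {M : Type*} [AddCommGroup M] [Module ℂ M] [SuperSpace M]
  (ρ : LieSuperHom (W m n) (Module.End ℂ M))

/-- The action of `d_i` on a `W_{m,n}`-module. -/
def cartanAct (i : Fin m) : Module.End ℂ M := ρ.toLin (euler m n i)

/-- `M` is nonzero and has no proper nonzero graded submodule. -/
def IsSimpleRep : Prop :=
  Nontrivial M ∧ ∀ S : Submodule ℂ M,
    S = (S ⊓ par (V := M) 0) ⊔ (S ⊓ par (V := M) 1) →
    (∀ x : W m n, ∀ v ∈ S, ρ.toLin x v ∈ S) → S = ⊥ ∨ S = ⊤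

/-- `W_{m,n}` acts by zero. -/
def IsTrivialRep : Prop := ∀ (x : W m n) (v : M), ρ.toLin x v = 0

/-- `𝔥` acts diagonalizably with finite-dimensional weight spaces. -/
def IsStrongHarishChandra : Prop :=
  (⨆ μ : Fin m → ℂ, wtSpace (cartanAct ρ) μ) = ⊤ ∧
    ∀ μ : Fin m → ℂ, FiniteDimensional ℂ (wtSpace (cartanAct ρ) μ)

end Modules

/-! ### The root subdivisions attached to an extremal weight -/

/-- The weight `ε_i`. -/
def eps {m : ℕ} (i : Fin m) : Fin m → ℂ := Pi.single i 1

/-- `Δ' = {ε_i - ε_j, ε_i, -ε_i | i ≠ j}`, the roots of `𝔰𝔩_{m+1} ⊆ W_{m,0}`. -/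
def slRoots (m : ℕ) : Set (Fin m → ℂ) :=
  {α | (∃ i j : Fin m, i ≠ j ∧ α = eps i - eps j) ∨ (∃ i : Fin m, α = eps i) ∨
    ∃ i : Fin m, α = -eps i}

section Shadow

variable {m n : ℕ} {M : Type*} [AddCommGroup M] [Module ℂ M] [SuperSpace M]
  (ρ : LieSuperHom (W m n) (Module.End ℂ M)) (μ : Fin m → ℂ)

/-- The set of real `r` with `μ + r α ∈ supp M`. -/
def rootString (α : Fin m → ℂ) : Set ℝ := {r | μ + r • α ∈ support (cartanAct ρ)}

/-- `Δ'^+`: the string through `μ` is bounded only from above. -/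
def shadowPos : Set (Fin m → ℂ) :=
  {α ∈ slRoots m | BddAbove (rootString ρ μ α) ∧ ¬ BddBelow (rootString ρ μ α)}

/-- `Δ'^-`: the string through `μ` is bounded only from below. -/
def shadowNeg : Set (Fin m → ℂ) :=
  {α ∈ slRoots m | BddBelow (rootString ρ μ α) ∧ ¬ BddAbove (rootString ρ μ α)}

/-- `Δ'^F`: the string through `μ` is bounded in both directions. -/
def shadowFin : Set (Fin m → ℂ) :=
  {α ∈ slRoots m | BddAbove (rootString ρ μ α) ∧ BddBelow (rootString ρ μ α)}

/-- `Δ'^I`: the string through `μ` is unbounded in both directions. -/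
def shadowInf : Set (Fin m → ℂ) :=
  {α ∈ slRoots m | ¬ BddAbove (rootString ρ μ α) ∧ ¬ BddBelow (rootString ρ μ α)}

/-- `K_μ`. -/
def extK : Set (Fin m → ℂ) := {α ∈ slRoots m | μ + α ∉ support (cartanAct ρ)}

/-- `μ` is an extremal weight of `M`: a weight for which `K_μ` is maximal. -/
def IsExtremal : Prop :=
  μ ∈ support (cartanAct ρ) ∧
    ∀ ν ∈ support (cartanAct ρ), ¬ (extK ρ μ ⊂ extK ρ ν)

/-- The roots `α ∈ Δ'^F` with `(μ, α) = 0`, where `(ε_i, ε_j) = δ_{ij}`. -/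
def finZero : Set (Fin m → ℂ) := {α ∈ shadowFin ρ μ | μ ⬝ᵥ α = 0}

/-- A subdivision into positive, zero and negative parts. -/
structure RootSubdivision (m : ℕ) where
  pos : Set (Fin m → ℂ)
  zero : Set (Fin m → ℂ)
  neg : Set (Fin m → ℂ)

/-- The parabolic decomposition of `Δ'` attached to the weight `μ` and to a triangular decomposition
`P ⊔ N` of `finZero ρ μ`: the positive (negative) part consists of `Δ'^±`, of the
`α ∈ Δ'^F` with `±(μ, α) > 0`, and of `P` (of `N`); the zero part is `Δ'^I`. -/
def slSubdivision (P N : Set (Fin m → ℂ)) : RootSubdivision m where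
  pos := shadowPos ρ μ ∪ {α ∈ shadowFin ρ μ | ∃ r : ℝ, 0 < r ∧ μ ⬝ᵥ α = r} ∪ P
  zero := shadowInf ρ μ
  neg := shadowNeg ρ μ ∪ {α ∈ shadowFin ρ μ | ∃ r : ℝ, r < 0 ∧ μ ⬝ᵥ α = r} ∪ N

/-- The parabolic decomposition of `Δ = Δ(W_{m,n})` that is induced by a parabolic
decomposition of `Δ'`:
`Δ^0 = Δ ∩ ⟨Δ'^0⟩_ℤ`, `Δ^+ = (Δ ∩ ⟨Δ'^+ ∪ Δ'^0⟩_{ℤ₊}) \ Δ^0`, and `Δ^-` is the rest. -/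
def RootSubdivision.extend (n : ℕ) (S : RootSubdivision m) : RootSubdivision m where
  zero := roots (adEuler m n) ∩ (AddSubgroup.closure S.zero : Set (Fin m → ℂ))
  pos := (roots (adEuler m n) ∩ (AddSubmonoid.closure (S.pos ∪ S.zero) : Set (Fin m → ℂ))) \
    (AddSubgroup.closure S.zero : Set (Fin m → ℂ))
  neg := roots (adEuler m n) \ ((AddSubgroup.closure S.zero : Set (Fin m → ℂ)) ∪
    (AddSubmonoid.closure (S.pos ∪ S.zero) : Set (Fin m → ℂ)))

/-- The Levi subalgebra `W_0 ⊕ ⨁_{α ∈ Δ^0} W_α` of the parabolic subalgebra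
`W_0 ⊕ ⨁_{α ∈ Δ^0 ⊔ Δ^+} W_α` of `W_{m,n}` attached to `μ`, `P` and `N`. -/
def leviOfWeight (P N : Set (Fin m → ℂ)) : Submodule ℂ (W m n) :=
  leviSpace (adEuler m n) ((slSubdivision ρ μ P N).extend n).zero

end Shadow

/-- The Lie superalgebra `W_{q,n} ⋉ (𝔨 ⊗ A_{q,n})`, with
`[D, x ⊗ f] = x ⊗ D(f)` and `[x ⊗ f, y ⊗ g] = [x, y] ⊗ f g`. -/
abbrev LeviModel (q n : ℕ) (k : Type*) [LieRing k] [LieAlgebra ℂ k] :=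
  Semidirect (currentAction k (PolyExt q n))

end

end SuperWitt

/-! Let `G` be the subgroup of weights generated by `Δ'^I`. The Levi subalgebra is the sum of `W_0`
and the root spaces with roots in `G`, so its shape depends only on `G`. Since the generators are of
the form `ε_i - ε_j` or `±ε_i`, the group `G` is described combinatorially
(`exists_block_structure`). Let `q` be the number of indices with `ε_i ∈ G`, and divide the other `r
= m - q` indices into blocks, `i` and `j` being in the same block when `ε_i - ε_j ∈ G`. Then the
coordinates of any `α ∈ G` add up to zero over each block.

Attach to each block its Euler operator, the sum of the `t_i ∂/∂t_i` over the block. The Levi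
subalgebra turns out to be the centralizer of these operators. Write `A_{m,n} = ℂ[t_1, …, t_r] ⊗ B`
with `B = A_{q,n}`. A superderivation commuting with all block Euler operators preserves the degree
in each block. Hence it maps `1 ⊗ B` to itself, and it maps a variable `t_j` to `∑ t_i ⊗ f_{ij}`,
the sum running over the block of `j`. It is therefore `1 ⊗ D + ∑ f_{ij} t_i ∂/∂t_j`, with `D` a
superderivation of `B` and `(f_{ij})` a block-diagonal matrix over `B`; this is an element of
`W_{q,n} ⋉ (k ⊗ B)` with `k` the block-diagonal matrices (`exists_eq_of_comm_blockEuler`). The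
presentation is unique (`semidirectHom_injective`).

The proof closes a cycle of inclusions. The Levi subalgebra centralizes the block Euler operators by
the vanishing of block sums (`comm_of_mem_leviSpace`). Their centralizer lies in the image of the
semidirect product (`mem_range_leviHom`). That image is spanned by vectors with weights in `G`
(`range_leviHom_le`); here the finite dimension of the exterior algebra makes every superderivation
a finite sum of weight vectors. Finally, `k` is a Levi subalgebra of `𝔤𝔩_r` because a real
functional that is constant exactly on blocks defines a parabolic decomposition
(`isLeviOfGl_blockSubalgebra`). -/

namespace SuperWitt

noncomputable section

open SuperSpace (par)
open LieSuperalgebra (br)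

/-! ### Superderivations and brackets with even operators -/

section SuperDerBasics

variable {A : Type*} [Ring A] [Algebra ℂ A] [SuperSpace A]

/-- No sign occurs against an even operator, so `T` need not be homogeneous. This lets the Euler
operators be bracketed with arbitrary elements of `W_{m,n}`. -/
theorem superComm_even_left {V : Type*} [AddCommGroup V] [Module ℂ V] [SuperSpace V]
    {D : Module.End ℂ V} (hD : D ∈ endPar V 0) (T : Module.End ℂ V) :
    superComm V D T = D * T - T * D := by
  have h0 : evenProj (Module.End ℂ V) T ∈ endPar V 0 := evenProj_mem T
  have h1 : oddProj (Module.End ℂ V) T ∈ endPar V 1 := oddProj_mem T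
  rw [← even_add_odd T, map_add, superComm_apply hD h0, superComm_apply hD h1]
  simp only [koszul_zero_left, one_smul, mul_add, add_mul]
  abel

theorem superComm_add_add {V : Type*} [AddCommGroup V] [Module ℂ V] [SuperSpace V]
    (D E F G : Module.End ℂ V) : superComm V (D + E) (F + G) =
      superComm V D F + superComm V D G + (superComm V E F + superComm V E G) := by
  rw [map_add, map_add (superComm V) D E, LinearMap.add_apply, LinearMap.add_apply]
  abel

/-- The Koszul sign is trivial when the first factor is even, so both parity components of `T` obey
the same rule. It is applied to polynomials, which are even. -/
theorem superDer_even_mul {T : Module.End ℂ A} (hT : T ∈ superDerSubmodule A) {a : A}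
    (ha : a ∈ par (V := A) 0) (b : A) : T (a * b) = T a * b + a * T b := by
  obtain ⟨T0, h0, T1, h1, rfl⟩ := Submodule.mem_sup.1 hT
  simp only [LinearMap.add_apply, h0.2 0 a ha, h1.2 0 a ha, koszul_zero_right, one_smul, add_mul,
    mul_add]
  abel

theorem superDer_one {A : Type*} [Ring A] [Algebra ℂ A] [SuperCommAlgebra A]
    {T : Module.End ℂ A} (hT : T ∈ superDerSubmodule A) :
    T 1 = 0 := by
  have h := superDer_even_mul hT SuperCommAlgebra.one_mem 1
  simpa using h

theorem derToEnd_injective : Function.Injective (derToEnd A) := Subtype.val_injective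

theorem derToEnd_mem (T : SuperDer A) : derToEnd A T ∈ superDerSubmodule A := T.2

end SuperDerBasics

/-! ### Superderivations of a tensor product, and the action of `Der A ⋉ (K ⊗ A)` on `R ⊗ A` -/

section TensorDerivations

variable {R A : Type*} [CommRing R] [Algebra ℂ R] [Ring A] [Algebra ℂ A] [SuperCommAlgebra A]

theorem map_mem_endPar {V B : Type*} [AddCommGroup V] [Module ℂ V] [AddCommGroup B] [Module ℂ B]
    [SuperSpace B] (f : V →ₗ[ℂ] V) {i : ZMod 2} {D : Module.End ℂ B} (hD : D ∈ endPar B i) :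
    (TensorProduct.map f D : Module.End ℂ (V ⊗[ℂ] B)) ∈ endPar (V ⊗[ℂ] B) i := by
  intro j v hv
  induction v, hv using tensor_par_induction with
  | zero => simp
  | add x y _ _ hx hy => rw [map_add]; exact Submodule.add_mem _ hx hy
  | tmul x b hb => exact tmul_mem_par _ (hD j b hb)

theorem lTensor_mem_endPar {i : ZMod 2} {D : Module.End ℂ A} (hD : D ∈ endPar A i) :
    (LinearMap.lTensor R D : Module.End ℂ (R ⊗[ℂ] A)) ∈ endPar (R ⊗[ℂ] A) i :=
  map_mem_endPar LinearMap.id hD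

theorem mulLeft_mem_endPar {i : ZMod 2} {f : A} (hf : f ∈ par (V := A) i) :
    LinearMap.mulLeft ℂ f ∈ endPar A i := fun _ _ hv => SuperCommAlgebra.mul_mem hf hv

/-- The operator `δ ⊗ f` is a superderivation of `R ⊗ A`. -/
theorem map_derivation_mulLeft_mem (δ : Derivation ℂ R R) {i : ZMod 2} {f : A}
    (hf : f ∈ par (V := A) i) :
    (TensorProduct.map δ.toLinearMap (LinearMap.mulLeft ℂ f) : Module.End ℂ (R ⊗[ℂ] A)) ∈
      derPar (R ⊗[ℂ] A) i := by
  refine ⟨map_mem_endPar _ (mulLeft_mem_endPar hf), fun j a ha b => ?_⟩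
  induction a, ha using tensor_par_induction with
  | zero => simp
  | add x y _ _ hx hy => simp only [add_mul, map_add, hx, hy, smul_add]; abel
  | tmul r u hu =>
    induction b with
    | zero => simp
    | add x y hx hy => simp only [mul_add, map_add, hx, hy, smul_add]; abel
    | tmul s w =>
      simp only [Algebra.TensorProduct.tmul_mul_tmul, TensorProduct.map_tmul,
        Derivation.coeFn_coe, Derivation.leibniz, smul_eq_mul, TensorProduct.add_tmul,
        LinearMap.mulLeft_apply]
      rw [← TensorProduct.tmul_smul, ← mul_assoc u f w, ← smul_mul_assoc,
        ← SuperCommAlgebra.mul_comm hf hu, mul_assoc, add_comm, mul_comm s]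

/-- The operator `r ⊗ D` is a superderivation of `R ⊗ A`. -/
theorem map_mulLeft_derivation_mem (r : R) {i : ZMod 2} {D : Module.End ℂ A}
    (hD : D ∈ derPar A i) :
    (TensorProduct.map (LinearMap.mulLeft ℂ r) D : Module.End ℂ (R ⊗[ℂ] A)) ∈
      derPar (R ⊗[ℂ] A) i := by
  refine ⟨map_mem_endPar _ hD.1, fun j a ha b => ?_⟩
  induction a, ha using tensor_par_induction with
  | zero => simp
  | add x y _ _ hx hy => simp only [add_mul, map_add, hx, hy, smul_add]; abel
  | tmul p u hu =>
    induction b with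
    | zero => simp
    | add x y hx hy => simp only [mul_add, map_add, hx, hy, smul_add]; abel
    | tmul s w =>
      simp only [Algebra.TensorProduct.tmul_mul_tmul, TensorProduct.map_tmul,
        LinearMap.mulLeft_apply, hD.2 j u hu, TensorProduct.tmul_add, TensorProduct.tmul_smul]
      rw [mul_assoc r p s, mul_left_comm p r s]

theorem map_derivation_mulLeft_mem_superDer (δ : Derivation ℂ R R) (f : A) :
    (TensorProduct.map δ.toLinearMap (LinearMap.mulLeft ℂ f) : Module.End ℂ (R ⊗[ℂ] A)) ∈
      superDerSubmodule (R ⊗[ℂ] A) := by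
  have h : LinearMap.mulLeft ℂ f =
      LinearMap.mulLeft ℂ (evenProj A f) + LinearMap.mulLeft ℂ (oddProj A f) := by
    ext x; simp [← add_mul, even_add_odd]
  rw [h, TensorProduct.map_add_right]
  exact Submodule.add_mem _ (derPar_le 0 (map_derivation_mulLeft_mem δ (evenProj_mem f)))
    (derPar_le 1 (map_derivation_mulLeft_mem δ (oddProj_mem f)))

theorem map_mulLeft_derivation_mem_superDer (r : R) {D : Module.End ℂ A}
    (hD : D ∈ superDerSubmodule A) :
    (TensorProduct.map (LinearMap.mulLeft ℂ r) D : Module.End ℂ (R ⊗[ℂ] A)) ∈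
      superDerSubmodule (R ⊗[ℂ] A) := by
  obtain ⟨D0, h0, D1, h1, rfl⟩ := Submodule.mem_sup.1 hD
  rw [TensorProduct.map_add_right]
  exact Submodule.add_mem _ (derPar_le 0 (map_mulLeft_derivation_mem r h0))
    (derPar_le 1 (map_mulLeft_derivation_mem r h1))

omit [SuperCommAlgebra A] in
theorem lTensor_eq_map_mulLeft (D : Module.End ℂ A) :
    LinearMap.lTensor R D = TensorProduct.map (LinearMap.mulLeft ℂ (1 : R)) D := by
  rw [LinearMap.mulLeft_one]; rfl

theorem lTensor_mem_derPar {i : ZMod 2} {D : Module.End ℂ A} (hD : D ∈ derPar A i) :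
    (LinearMap.lTensor R D : Module.End ℂ (R ⊗[ℂ] A)) ∈ derPar (R ⊗[ℂ] A) i := by
  rw [lTensor_eq_map_mulLeft]; exact map_mulLeft_derivation_mem 1 hD

theorem lTensor_mem_superDer {D : Module.End ℂ A} (hD : D ∈ superDerSubmodule A) :
    (LinearMap.lTensor R D : Module.End ℂ (R ⊗[ℂ] A)) ∈ superDerSubmodule (R ⊗[ℂ] A) := by
  rw [lTensor_eq_map_mulLeft]; exact map_mulLeft_derivation_mem_superDer 1 hD

variable {K : Type*} [LieRing K] [LieAlgebra ℂ K] (φ : K →ₗ⁅ℂ⁆ Derivation ℂ R R)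

/-- The action of `K ⊗ A` on `R ⊗ A`, for a Lie algebra `K` acting on `R` by derivations. -/
def currentOp (A : Type*) [Ring A] [Algebra ℂ A] [SuperCommAlgebra A] :
    K ⊗[ℂ] A →ₗ[ℂ] Module.End ℂ (R ⊗[ℂ] A) :=
  TensorProduct.lift (LinearMap.mk₂ ℂ
    (fun x f => TensorProduct.map (φ x).toLinearMap (LinearMap.mulLeft ℂ f))
    (fun x y f => by
      rw [map_add, ← TensorProduct.map_add_left]; rfl)
    (fun c x f => by
      rw [map_smul, ← TensorProduct.map_smul_left]; rfl)
    (fun x f g => by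
      rw [← TensorProduct.map_add_right]; congr 1; ext; simp [add_mul])
    (fun c x f => by
      rw [← TensorProduct.map_smul_right]; congr 1; ext; simp))

@[simp] theorem currentOp_tmul (x : K) (f : A) :
    currentOp φ A (x ⊗ₜ f) = TensorProduct.map (φ x).toLinearMap (LinearMap.mulLeft ℂ f) := rfl

theorem currentOp_mem_superDer (u : K ⊗[ℂ] A) :
    currentOp φ A u ∈ superDerSubmodule (R ⊗[ℂ] A) := by
  induction u with
  | zero => simp
  | add x y hx hy => rw [map_add]; exact Submodule.add_mem _ hx hy
  | tmul x f => exact map_derivation_mulLeft_mem_superDer _ f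

theorem currentOp_mem_derPar {i : ZMod 2} {u : K ⊗[ℂ] A} (hu : u ∈ par (V := K ⊗[ℂ] A) i) :
    currentOp φ A u ∈ derPar (R ⊗[ℂ] A) i := by
  induction u, hu using tensor_par_induction with
  | zero => simp
  | add x y _ _ hx hy => rw [map_add]; exact Submodule.add_mem _ hx hy
  | tmul x f hf => exact map_derivation_mulLeft_mem _ hf

/-- This and the next two lemmas match the three constituents of the semidirect bracket: `[D, E]`,
the action `D · u`, and `[u, v]`. -/
theorem superComm_lTensor {i j : ZMod 2} {D E : Module.End ℂ A} (hD : D ∈ endPar A i)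
    (hE : E ∈ endPar A j) :
    superComm (R ⊗[ℂ] A) (LinearMap.lTensor R D) (LinearMap.lTensor R E) =
      LinearMap.lTensor R (superComm A D E) := by
  rw [superComm_apply (lTensor_mem_endPar hD) (lTensor_mem_endPar hE), superComm_apply hD hE,
    LinearMap.lTensor_sub, LinearMap.lTensor_smul, LinearMap.lTensor_mul, LinearMap.lTensor_mul]

theorem superComm_lTensor_currentOp {i j : ZMod 2} {D : Module.End ℂ A} (hD : D ∈ derPar A i)
    {u : K ⊗[ℂ] A} (hu : u ∈ par (V := K ⊗[ℂ] A) j) :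
    superComm (R ⊗[ℂ] A) (LinearMap.lTensor R D) (currentOp φ A u) =
      currentOp φ A (LinearMap.lTensor K D u) := by
  induction u, hu using tensor_par_induction with
  | zero => simp
  | add x y _ _ hx hy => simp only [map_add, hx, hy]
  | tmul x f hf =>
    rw [currentOp_tmul, superComm_apply (lTensor_mem_endPar hD.1)
      (map_mem_endPar _ (mulLeft_mem_endPar hf))]
    ext r a
    simp [hD.2 j f hf, TensorProduct.tmul_add, TensorProduct.tmul_smul]

theorem superComm_currentOp {i j : ZMod 2} {u v : K ⊗[ℂ] A} (hu : u ∈ par (V := K ⊗[ℂ] A) i)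
    (hv : v ∈ par (V := K ⊗[ℂ] A) j) :
    superComm (R ⊗[ℂ] A) (currentOp φ A u) (currentOp φ A v) = currentOp φ A (br u v) := by
  induction u, hu using tensor_par_induction with
  | zero => simp
  | add x y _ _ hx hy => simp only [map_add, LinearMap.add_apply, hx, hy]
  | tmul x f hf =>
    induction v, hv using tensor_par_induction with
    | zero => simp
    | add x y _ _ hx hy => simp only [map_add, hx, hy]
    | tmul y g hg =>
      rw [show br (x ⊗ₜ[ℂ] f) (y ⊗ₜ[ℂ] g) = ⁅x, y⁆ ⊗ₜ[ℂ] (f * g) from currentBr_tmul x y f g,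
        currentOp_tmul, currentOp_tmul, currentOp_tmul,
        superComm_apply (map_mem_endPar _ (mulLeft_mem_endPar hf))
        (map_mem_endPar _ (mulLeft_mem_endPar hg))]
      ext r a
      simp only [TensorProduct.AlgebraTensorModule.curry_apply, LinearMap.restrictScalars_self,
        TensorProduct.curry_apply, LinearMap.sub_apply, LinearMap.smul_apply,
        Module.End.mul_apply, TensorProduct.map_tmul, LinearMap.mulLeft_apply,
        Derivation.coeFn_coe, LieHom.map_lie, Derivation.commutator_apply, TensorProduct.sub_tmul]
      rw [← TensorProduct.tmul_smul, ← mul_assoc g f a, ← smul_mul_assoc,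
        ← SuperCommAlgebra.mul_comm hf hg, mul_assoc]

/-- The linear map underlying `semidirectHom`. -/
def semidirectLin (A : Type*) [Ring A] [Algebra ℂ A] [SuperCommAlgebra A] :
    Semidirect (currentAction K A) →ₗ[ℂ] SuperDer (R ⊗[ℂ] A) :=
  LinearMap.codRestrict (superDerSubmodule (R ⊗[ℂ] A))
    (LinearMap.coprod (LinearMap.lTensorHom R ∘ₗ derToEnd A) (currentOp φ A) :
      (SuperDer A × K ⊗[ℂ] A) →ₗ[ℂ] Module.End ℂ (R ⊗[ℂ] A))
    (fun x => Submodule.add_mem _ (lTensor_mem_superDer x.1.2) (currentOp_mem_superDer φ x.2))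

/-- For a Lie algebra `K` acting on `R` by derivations, the action of
`Der A ⋉ (K ⊗ A)` on `R ⊗ A` by superderivations. -/
def semidirectHom (A : Type*) [Ring A] [Algebra ℂ A] [SuperCommAlgebra A] :
    LieSuperHom (Semidirect (currentAction K A)) (SuperDer (R ⊗[ℂ] A)) where
  toLin := semidirectLin φ A
  map_par h := Submodule.add_mem _ (lTensor_mem_derPar h.1) (currentOp_mem_derPar φ h.2)
  map_br := map_br_of_homogeneous (L := Semidirect (currentAction K A))
    (L' := SuperDer (R ⊗[ℂ] A)) _ <| by
    rintro i j ⟨D, u⟩ ⟨E, v⟩ ⟨hD, hu⟩ ⟨hE, hv⟩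
    have hD' : derToEnd A D ∈ derPar A i := hD
    have hE' : derToEnd A E ∈ derPar A j := hE
    refine derToEnd_injective ?_
    change LinearMap.lTensor R (derToEnd A (br D E)) +
        currentOp φ A (semidirectBr (currentAction K A) (D, u) (E, v)).2 =
      superComm (R ⊗[ℂ] A) (LinearMap.lTensor R (derToEnd A D) + currentOp φ A u)
        (LinearMap.lTensor R (derToEnd A E) + currentOp φ A v)
    refine Eq.trans ?_ (superComm_add_add _ _ _ _).symm
    -- The supercommutator of `u` with `E` is reversed by skew-symmetry; this produces the signed
    -- term `E · u` of the semidirect bracket.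
    rw [semidirectBr_snd _ hu hE, derToEnd_br, map_add (currentOp φ A), superComm_lTensor hD'.1 hE'.1, superComm_lTensor_currentOp φ hD' hv,
      superComm_currentOp φ hu hv,
      superComm_skew (currentOp_mem_derPar φ hu).1 (lTensor_mem_derPar hE').1,
      superComm_lTensor_currentOp φ hE' hu]
    have e1 : (currentAction K A).toLin D v = LinearMap.lTensor K (derToEnd A D) v := rfl
    have e2 : (currentAction K A).toLin E u = LinearMap.lTensor K (derToEnd A E) u := rfl
    have hk : koszul j i = koszul i j := by simp [koszul, and_comm]
    simp only [map_sub, map_smul, e1, e2, hk]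
    abel

theorem derToEnd_semidirectHom (D : SuperDer A) (u : K ⊗[ℂ] A) :
    derToEnd (R ⊗[ℂ] A) ((semidirectHom φ A).toLin (D, u)) =
      LinearMap.lTensor R (derToEnd A D) + currentOp φ A u := rfl

end TensorDerivations

/-! ### Restricting a superderivation of `R ⊗ A` to `A` along a functional on `R` -/

section Slice

variable {R A : Type*} [CommRing R] [Algebra ℂ R] [Ring A] [Algebra ℂ A] [SuperCommAlgebra A]

/-- The map `c ⊗ 1 : R ⊗ A → A` for a linear functional `c` on `R`. -/
def slice (A : Type*) [Ring A] [Algebra ℂ A] (c : R →ₗ[ℂ] ℂ) : R ⊗[ℂ] A →ₗ[ℂ] A :=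
  (TensorProduct.lid ℂ A).toLinearMap ∘ₗ c.rTensor A

omit [SuperCommAlgebra A] in
@[simp] theorem slice_tmul (c : R →ₗ[ℂ] ℂ) (r : R) (a : A) : slice A c (r ⊗ₜ a) = c r • a := by
  simp [slice]

theorem slice_mem (c : R →ₗ[ℂ] ℂ) {i : ZMod 2} {x : R ⊗[ℂ] A} (hx : x ∈ par (V := R ⊗[ℂ] A) i) :
    slice A c x ∈ par (V := A) i := by
  induction x, hx using tensor_par_induction with
  | zero => simp
  | add x y _ _ hx hy => rw [map_add]; exact Submodule.add_mem _ hx hy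
  | tmul r a ha => rw [slice_tmul]; exact Submodule.smul_mem _ _ ha

omit [SuperCommAlgebra A] in
theorem slice_mul_right (c : R →ₗ[ℂ] ℂ) (x : R ⊗[ℂ] A) (b : A) :
    slice A c (x * (1 ⊗ₜ b)) = slice A c x * b := by
  induction x with
  | zero => simp
  | add x y hx hy => simp only [add_mul, map_add, hx, hy]
  | tmul r a => simp [Algebra.TensorProduct.tmul_mul_tmul]

omit [SuperCommAlgebra A] in
theorem slice_mul_left (c : R →ₗ[ℂ] ℂ) (x : R ⊗[ℂ] A) (b : A) :
    slice A c ((1 ⊗ₜ b) * x) = b * slice A c x := by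
  induction x with
  | zero => simp
  | add x y hx hy => simp only [mul_add, map_add, hx, hy]
  | tmul r a => simp [Algebra.TensorProduct.tmul_mul_tmul]

/-- The operator `a ↦ (c ⊗ 1) (T (1 ⊗ a))` on `A`. -/
def restrictOp (c : R →ₗ[ℂ] ℂ) (T : Module.End ℂ (R ⊗[ℂ] A)) : Module.End ℂ A :=
  slice A c ∘ₗ T ∘ₗ TensorProduct.mk ℂ R A 1

omit [SuperCommAlgebra A] in
@[simp] theorem restrictOp_apply (c : R →ₗ[ℂ] ℂ) (T : Module.End ℂ (R ⊗[ℂ] A)) (a : A) :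
    restrictOp c T a = slice A c (T (1 ⊗ₜ a)) := rfl

/-- Slicing commutes with left and right multiplication by `1 ⊗ b`, so the Leibniz rule on `1 ⊗ A`
survives. Coefficients of `T (1 ⊗ a)` in the polynomial variables are thus superderivations in `a`.
-/
theorem restrictOp_mem_derPar (c : R →ₗ[ℂ] ℂ) {i : ZMod 2} {T : Module.End ℂ (R ⊗[ℂ] A)}
    (hT : T ∈ derPar (R ⊗[ℂ] A) i) : restrictOp c T ∈ derPar A i := by
  refine ⟨fun j v hv => slice_mem c (hT.1 j _ (tmul_mem_par _ hv)), fun j a ha b => ?_⟩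
  have h := hT.2 j (1 ⊗ₜ a) (tmul_mem_par _ ha) (1 ⊗ₜ b)
  rw [Algebra.TensorProduct.tmul_mul_tmul, one_mul] at h
  simp only [restrictOp_apply, h, map_add, map_smul, slice_mul_left, slice_mul_right]

theorem restrictOp_mem_superDer (c : R →ₗ[ℂ] ℂ) {T : Module.End ℂ (R ⊗[ℂ] A)}
    (hT : T ∈ superDerSubmodule (R ⊗[ℂ] A)) : restrictOp c T ∈ superDerSubmodule A := by
  obtain ⟨T0, h0, T1, h1, rfl⟩ := Submodule.mem_sup.1 hT
  have h : restrictOp c (T0 + T1) = restrictOp c T0 + restrictOp c T1 := by ext; simp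
  rw [h]
  exact Submodule.add_mem _ (derPar_le 0 (restrictOp_mem_derPar c h0))
    (derPar_le 1 (restrictOp_mem_derPar c h1))

end Slice

/-! ### Coefficients in `ℂ[t] ⊗ A` and Euler operators -/

section Polynomial

variable {σ : Type*} {A : Type*} [Ring A] [Algebra ℂ A]

/-- The coefficient of `t^β` of an element of `ℂ[t] ⊗ A`. -/
def coeffA (A : Type*) [Ring A] [Algebra ℂ A] (β : σ →₀ ℕ) :
    MvPolynomial σ ℂ ⊗[ℂ] A →ₗ[ℂ] A :=
  slice A (MvPolynomial.lcoeff ℂ β)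

@[simp] theorem coeffA_tmul (β : σ →₀ ℕ) (p : MvPolynomial σ ℂ) (a : A) :
    coeffA A β (p ⊗ₜ a) = p.coeff β • a := slice_tmul _ _ _

/-- Identifies the coefficients with coordinates in the monomial basis; finite support and
reconstruction from coefficients follow. -/
theorem coeffA_eq_equivFinsupp [DecidableEq σ] (β : σ →₀ ℕ) (x : MvPolynomial σ ℂ ⊗[ℂ] A) :
    coeffA A β x =
      TensorProduct.equivFinsuppOfBasisLeft (MvPolynomial.basisMonomials σ ℂ) x β := by
  induction x with
  | zero => simp
  | add x y hx hy => simp only [map_add, hx, hy, Finsupp.add_apply]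
  | tmul p a => rw [coeffA_tmul, TensorProduct.equivFinsuppOfBasisLeft_apply_tmul_apply]; rfl

theorem exists_coeffA_eq_zero (x : MvPolynomial σ ℂ ⊗[ℂ] A) :
    ∃ S : Finset (σ →₀ ℕ), ∀ β ∉ S, coeffA A β x = 0 := by
  classical
  refine ⟨(TensorProduct.equivFinsuppOfBasisLeft (MvPolynomial.basisMonomials σ ℂ) x).support,
    fun β hβ => ?_⟩
  rw [coeffA_eq_equivFinsupp]
  exact Finsupp.notMem_support_iff.1 hβ

theorem eq_sum_coeffA {x : MvPolynomial σ ℂ ⊗[ℂ] A} {S : Finset (σ →₀ ℕ)}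
    (h : ∀ β ∉ S, coeffA A β x = 0) :
    x = ∑ β ∈ S, MvPolynomial.monomial β 1 ⊗ₜ coeffA A β x := by
  classical
  apply (TensorProduct.equivFinsuppOfBasisLeft (MvPolynomial.basisMonomials σ ℂ)).injective
  ext γ
  rw [← coeffA_eq_equivFinsupp, ← coeffA_eq_equivFinsupp, map_sum]
  simp only [coeffA_tmul, MvPolynomial.coeff_monomial, ite_smul, one_smul, zero_smul,
    Finset.sum_ite_eq']
  split_ifs with hγ
  · rfl
  · exact h γ hγ

variable {r : ℕ}

theorem polyEuler_X (i j : Fin r) :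
    polyEuler r i (MvPolynomial.X j) = if i = j then MvPolynomial.X j else 0 := by
  rw [polyEuler, Derivation.smul_apply, MvPolynomial.pderiv_X]
  split_ifs with h
  · subst h; simp
  · rw [Pi.single_eq_of_ne (Ne.symm h), smul_zero]

theorem polyEuler_monomial (i : Fin r) (β : Fin r →₀ ℕ) (a : ℂ) :
    polyEuler r i (MvPolynomial.monomial β a) = (β i : ℂ) • MvPolynomial.monomial β a := by
  rw [polyEuler, Derivation.smul_apply, smul_eq_mul, MvPolynomial.X_mul_pderiv_monomial,
    Nat.cast_smul_eq_nsmul]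

theorem coeff_polyEuler (i : Fin r) (β : Fin r →₀ ℕ) (p : MvPolynomial (Fin r) ℂ) :
    (polyEuler r i p).coeff β = (β i : ℂ) * p.coeff β := by
  induction p using MvPolynomial.induction_on' with
  | monomial γ a =>
    rw [polyEuler_monomial, MvPolynomial.coeff_smul, MvPolynomial.coeff_monomial, smul_eq_mul]
    split_ifs with h
    · rw [h]
    · simp
  | add p q hp hq => simp only [map_add, MvPolynomial.coeff_add, hp, hq, mul_add]

/-- A superderivation of `ℂ[t] ⊗ A` is determined by its values on `A` and on the `t_i`. -/
theorem superDer_ext {A : Type*} [Ring A] [Algebra ℂ A] [SuperCommAlgebra A]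
    {T T' : Module.End ℂ (MvPolynomial σ ℂ ⊗[ℂ] A)}
    (hT : T ∈ superDerSubmodule (MvPolynomial σ ℂ ⊗[ℂ] A))
    (hT' : T' ∈ superDerSubmodule (MvPolynomial σ ℂ ⊗[ℂ] A))
    (hA : ∀ a : A, T (1 ⊗ₜ a) = T' (1 ⊗ₜ a))
    (hX : ∀ i : σ, T (MvPolynomial.X i ⊗ₜ 1) = T' (MvPolynomial.X i ⊗ₜ 1)) : T = T' := by
  have hmul : ∀ {T : Module.End ℂ (MvPolynomial σ ℂ ⊗[ℂ] A)},
      T ∈ superDerSubmodule (MvPolynomial σ ℂ ⊗[ℂ] A) →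
      ∀ (p : MvPolynomial σ ℂ) (x : MvPolynomial σ ℂ ⊗[ℂ] A),
      T ((p ⊗ₜ 1) * x) = T (p ⊗ₜ 1) * x + (p ⊗ₜ 1) * T x := fun hT p x =>
    superDer_even_mul hT (tmul_mem_par _ SuperCommAlgebra.one_mem) x
  have hp : ∀ p : MvPolynomial σ ℂ, T (p ⊗ₜ 1) = T' (p ⊗ₜ 1) := by
    intro p
    induction p using MvPolynomial.induction_on with
    | C c =>
      have : (MvPolynomial.C c : MvPolynomial σ ℂ) ⊗ₜ[ℂ] (1 : A) = c • (1 ⊗ₜ 1) := by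
        rw [TensorProduct.smul_tmul', MvPolynomial.smul_eq_C_mul, mul_one]
      rw [this, map_smul, map_smul, hA]
    | add p q hp hq => rw [TensorProduct.add_tmul, map_add, map_add, hp, hq]
    | mul_X p i hp =>
      have : (p * MvPolynomial.X i) ⊗ₜ[ℂ] (1 : A) = (p ⊗ₜ 1) * (MvPolynomial.X i ⊗ₜ 1) := by
        simp [Algebra.TensorProduct.tmul_mul_tmul]
      rw [this, hmul hT, hmul hT', hp, hX]
  refine TensorProduct.ext' fun p a => ?_
  have : p ⊗ₜ[ℂ] a = (p ⊗ₜ 1) * (1 ⊗ₜ a) := by simp [Algebra.TensorProduct.tmul_mul_tmul]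
  rw [this, hmul hT, hmul hT', hp, hA]

end Polynomial

section

attribute [local instance] LieRing.ofAssociativeRing

/-! ### Linear vector fields and the centralizer of the block Euler operators -/

section Gl

variable {r : ℕ}

/-- The action of `𝔤𝔩_r` on `ℂ[t_1, …, t_r]` by linear vector fields,
`x ↦ ∑ x_{ij} t_i ∂/∂t_j`. -/
def glDer (r : ℕ) : Matrix (Fin r) (Fin r) ℂ →ₗ⁅ℂ⁆
    Derivation ℂ (MvPolynomial (Fin r) ℂ) (MvPolynomial (Fin r) ℂ) where
  toFun x := MvPolynomial.mkDerivation ℂ fun j => ∑ i, x i j • MvPolynomial.X i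
  map_add' x y := by
    apply MvPolynomial.derivation_ext
    intro j
    simp [MvPolynomial.mkDerivation_X, add_smul, Finset.sum_add_distrib]
  map_smul' a x := by
    apply MvPolynomial.derivation_ext
    intro j
    simp [MvPolynomial.mkDerivation_X, mul_smul, Finset.smul_sum]
  map_lie' := by
    intro x y
    apply MvPolynomial.derivation_ext
    intro j
    simp only [MvPolynomial.mkDerivation_X, Derivation.commutator_apply, map_sum,
      Derivation.map_smul, LieRing.of_associative_ring_bracket, Matrix.sub_apply,
      Matrix.mul_apply, sub_smul, Finset.sum_smul, Finset.sum_sub_distrib, Finset.smul_sum,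
      smul_smul]
    congr 1
    · rw [Finset.sum_comm]
      simp only [mul_comm]
    · rw [Finset.sum_comm]
      simp only [mul_comm]

theorem glDer_X (x : Matrix (Fin r) (Fin r) ℂ) (j : Fin r) :
    glDer r x (MvPolynomial.X j) = ∑ i, x i j • MvPolynomial.X i :=
  MvPolynomial.mkDerivation_X _ _ _

/-- The block-diagonal matrices, for the partition of the index set into the fibres of `c`. -/
def blockSubalgebra (c : Fin r → ℝ) : GlSubalgebra r where
  carrier := {x | ∀ i j, c i ≠ c j → x i j = 0}
  add_mem' hx hy i j h := by simp [hx i j h, hy i j h]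
  zero_mem' _ _ _ := rfl
  smul_mem' a x hx i j h := by simp [hx i j h]
  lie_mem' := by
    intro x y hx hy i j h
    have key : ∀ x y : Matrix (Fin r) (Fin r) ℂ, (∀ i j, c i ≠ c j → x i j = 0) →
        (∀ i j, c i ≠ c j → y i j = 0) → (x * y) i j = 0 := by
      intro x y hx hy
      rw [Matrix.mul_apply]
      refine Finset.sum_eq_zero fun l _ => ?_
      by_cases hl : c i = c l
      · rw [hy l j (hl ▸ h), mul_zero]
      · rw [hx i l hl, zero_mul]
    rw [LieRing.of_associative_ring_bracket, Matrix.sub_apply, key x y hx hy, key y x hy hx,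
      sub_zero]

theorem single_mem_blockSubalgebra {c : Fin r → ℝ} {i j : Fin r} (h : c i = c j) :
    Matrix.single i j (1 : ℂ) ∈ blockSubalgebra c := by
  intro k l hkl
  rw [Matrix.single_apply]
  refine if_neg ?_
  rintro ⟨rfl, rfl⟩
  exact hkl h

variable {A : Type*} [Ring A] [Algebra ℂ A] [SuperCommAlgebra A]

/-- The action of a subalgebra of `𝔤𝔩_r` on `ℂ[t_1, …, t_r]`. -/
def subDer (k : GlSubalgebra r) :
    k →ₗ⁅ℂ⁆ Derivation ℂ (MvPolynomial (Fin r) ℂ) (MvPolynomial (Fin r) ℂ) :=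
  (glDer r).comp k.incl

theorem subDer_apply (k : GlSubalgebra r) (x : k) : subDer k x = glDer r x := rfl

/-- Derivations kill `1`. Hence the values on `1 ⊗ A` of a sum `1 ⊗ D + u` see only `D`. -/
theorem currentOp_one_tmul {R K : Type*} [CommRing R] [Algebra ℂ R] [LieRing K] [LieAlgebra ℂ K]
    (φ : K →ₗ⁅ℂ⁆ Derivation ℂ R R) (u : K ⊗[ℂ] A) (a : A) : currentOp φ A u (1 ⊗ₜ a) = 0 := by
  induction u with
  | zero => simp
  | add x y hx hy => rw [map_add, LinearMap.add_apply, hx, hy, add_zero]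
  | tmul x f => simp

/-- The matrix entries of `u` can be read off from its action on the variables, which makes the
current part of the action faithful. -/
theorem coeffA_currentOp_X (k : GlSubalgebra r) (u : k ⊗[ℂ] A) (i j : Fin r) :
    coeffA A (Finsupp.single i 1) (currentOp (subDer k) A u (MvPolynomial.X j ⊗ₜ 1)) =
      TensorProduct.lid ℂ A
        (LinearMap.rTensor A ((Matrix.entryLinearMap ℂ ℂ i j).comp k.toSubmodule.subtype) u) := by
  induction u with
  | zero => simp
  | add x y hx hy => simp only [map_add, LinearMap.add_apply, hx, hy]
  | tmul x f =>
    simp [subDer_apply, glDer_X, MvPolynomial.coeff_sum, MvPolynomial.coeff_X,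
      Finsupp.single_left_inj]

omit [SuperCommAlgebra A] in
/-- An element of `k ⊗ A`, for `k ⊆ 𝔤𝔩_r`, is determined by its matrix entries in `A`. -/
theorem eq_zero_of_entries (k : Submodule ℂ (Matrix (Fin r) (Fin r) ℂ)) (u : k ⊗[ℂ] A)
    (h : ∀ i j, TensorProduct.lid ℂ A
      (LinearMap.rTensor A ((Matrix.entryLinearMap ℂ ℂ i j).comp k.subtype) u) = 0) : u = 0 := by
  -- By flatness `k ⊗ A` embeds in `𝔤𝔩_r ⊗ A`, where the matrix units give coordinates.
  apply Module.Flat.rTensor_preserves_injective_linearMap (M := A) k.subtype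
    k.injective_subtype
  rw [map_zero]
  apply (TensorProduct.equivFinsuppOfBasisLeft (Matrix.stdBasis ℂ (Fin r) (Fin r))).injective
  ext ⟨i, j⟩
  rw [TensorProduct.equivFinsuppOfBasisLeft_apply, ← LinearMap.comp_apply (LinearMap.rTensor _ _),
    ← LinearMap.rTensor_comp, map_zero]
  refine Eq.trans ?_ (h i j)
  congr 3

/-- The constant coefficient of the value at `1 ⊗ a` is `D a`, so `D` vanishes on the kernel; then
the linear coefficients of the values at the variables are the entries of `u`. -/
theorem semidirectHom_injective (k : GlSubalgebra r) :
    Function.Injective (semidirectHom (subDer k) A).toLin := by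
  rw [← LinearMap.ker_eq_bot, LinearMap.ker_eq_bot']
  rintro ⟨D, u⟩ h
  have h' : LinearMap.lTensor (MvPolynomial (Fin r) ℂ) (derToEnd A D) + currentOp (subDer k) A u
      = 0 := by
    rw [← derToEnd_semidirectHom, h, map_zero]
  have hD : D = 0 := by
    refine derToEnd_injective (LinearMap.ext fun a => ?_)
    have h2 := congrArg (coeffA A 0) (LinearMap.congr_fun h' (1 ⊗ₜ a))
    simpa [currentOp_one_tmul] using h2
  subst hD
  rw [map_zero, LinearMap.lTensor_zero, zero_add] at h'
  have hu : u = 0 := by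
    refine eq_zero_of_entries k.toSubmodule u fun i j => ?_
    rw [← coeffA_currentOp_X, h']
    simp
  rw [hu]; rfl

/-- The Euler operator of the block of `j`. -/
def blockEuler (c : Fin r → ℝ) (j : Fin r) :
    Derivation ℂ (MvPolynomial (Fin r) ℂ) (MvPolynomial (Fin r) ℂ) :=
  ∑ i with c i = c j, polyEuler r i

theorem blockEuler_apply (c : Fin r → ℝ) (j : Fin r) (p : MvPolynomial (Fin r) ℂ) :
    blockEuler c j p = ∑ i with c i = c j, polyEuler r i p := by
  have h := map_sum (Derivation.coeFnAddMonoidHom (R := ℂ) (A := MvPolynomial (Fin r) ℂ)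
    (M := MvPolynomial (Fin r) ℂ)) (fun i => polyEuler r i)
    (Finset.univ.filter fun i => c i = c j)
  have h2 := congrFun h p
  rw [Finset.sum_apply] at h2
  exact h2

theorem blockEuler_X (c : Fin r → ℝ) (l j : Fin r) :
    blockEuler c l (MvPolynomial.X j) =
      (if c j = c l then (1 : ℂ) else 0) • MvPolynomial.X j := by
  rw [blockEuler_apply]
  simp [polyEuler_X, Finset.sum_ite_eq']

omit [SuperCommAlgebra A] in
-- The block Euler operator multiplies the coefficient of `t^β` by the degree of `β` in that block,
-- so its eigenspaces are the block-homogeneous elements.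
theorem coeffA_blockEuler (c : Fin r → ℝ) (j : Fin r) (β : Fin r →₀ ℕ)
    (x : MvPolynomial (Fin r) ℂ ⊗[ℂ] A) :
    coeffA A β (LinearMap.rTensor A (blockEuler c j).toLinearMap x) =
      ((∑ i with c i = c j, β i : ℕ) : ℂ) • coeffA A β x := by
  induction x with
  | zero => simp
  | add x y hx hy => simp only [map_add, hx, hy, smul_add]
  | tmul p a =>
    rw [LinearMap.rTensor_tmul, coeffA_tmul, coeffA_tmul, Derivation.coeFn_coe, blockEuler_apply,
      MvPolynomial.coeff_sum, smul_smul, Nat.cast_sum, Finset.sum_mul]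
    simp only [coeff_polyEuler]

omit [SuperCommAlgebra A] in
-- Every variable lies in some block, and exponents are nonnegative; block degrees that are all zero
-- leave only the constant monomial.
theorem eq_one_tmul_of_blockEuler (c : Fin r → ℝ) {x : MvPolynomial (Fin r) ℂ ⊗[ℂ] A}
    (h : ∀ j, LinearMap.rTensor A (blockEuler c j).toLinearMap x = 0) :
    x = 1 ⊗ₜ coeffA A 0 x := by
  have h : ∀ β ∉ ({0} : Finset (Fin r →₀ ℕ)), coeffA A β x = 0 := by
    intro β hβ
    obtain ⟨j, hj⟩ := Finsupp.ne_iff.1 (Finset.notMem_singleton.1 hβ)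
    have h2 := coeffA_blockEuler c j β x
    rw [h, map_zero] at h2
    refine (smul_eq_zero.1 h2.symm).resolve_left ?_
    rw [Nat.cast_eq_zero, Finset.sum_eq_zero_iff]
    intro h3
    exact hj (h3 j (by simp))
  have h4 := eq_sum_coeffA h
  rw [Finset.sum_singleton] at h4
  exact h4

omit [SuperCommAlgebra A] in
-- The eigenvalues say that `x` has degree one in the block of `j` and degree zero in the other
-- blocks. The only such monomials are the variables of that block.
theorem eq_sum_X_tmul_of_blockEuler (c : Fin r → ℝ) (j : Fin r)
    {x : MvPolynomial (Fin r) ℂ ⊗[ℂ] A}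
    (hx : ∀ l, LinearMap.rTensor A (blockEuler c l).toLinearMap x =
      (if c j = c l then (1 : ℂ) else 0) • x) :
    x = ∑ i with c i = c j, MvPolynomial.X i ⊗ₜ coeffA A (Finsupp.single i 1) x := by
  have h : ∀ β ∉ (Finset.univ.filter fun i => c i = c j).image
      (fun i => (Finsupp.single i 1 : Fin r →₀ ℕ)), coeffA A β x = 0 := by
    intro β hβ
    by_contra hne
    -- A nonzero coefficient at `β` forces the block degrees of `β` to equal the eigenvalues.
    have key : ∀ l, ∑ i with c i = c l, β i = if c j = c l then 1 else 0 := by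
      intro l
      have h2 := coeffA_blockEuler c l β x
      rw [hx, map_smul] at h2
      have h4 := smul_left_injective ℂ hne h2
      have h5 : ((∑ i with c i = c l, β i : ℕ) : ℂ) =
        ((if c j = c l then 1 else 0 : ℕ) : ℂ) := by rw [← h4]; push_cast; rfl
      exact_mod_cast h5
    have hj := key j
    rw [if_pos rfl] at hj
    obtain ⟨i, hi, hi1⟩ := Finset.exists_ne_zero_of_sum_ne_zero (hj.trans_ne one_ne_zero)
    rw [← Finset.add_sum_erase _ _ hi] at hj
    -- The block degree is one and `β i` is a nonzero natural number, so it uses up the whole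
    -- degree.
    have hi0 := Finset.sum_eq_zero_iff.1 (by omega :
      ∑ l ∈ (Finset.univ.filter fun i => c i = c j).erase i, β l = 0)
    replace hi1 : β i = 1 := by omega
    refine hβ (Finset.mem_image.2 ⟨i, hi, ?_⟩)
    ext l
    by_cases hl : c l = c j
    · by_cases hil : i = l
      · subst hil; simp [hi1]
      · rw [Finsupp.single_eq_of_ne' hil]
        exact (hi0 l (by simpa [Ne.symm hil] using hl)).symm
    · have h0 := key l
      rw [if_neg (Ne.symm hl), Finset.sum_eq_zero_iff] at h0
      have hil : i ≠ l := by
        rintro rfl; exact hl (Finset.mem_filter.1 hi).2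
      rw [Finsupp.single_eq_of_ne' hil]
      exact (h0 l (by simp)).symm
  have h4 := eq_sum_coeffA h
  rw [Finset.sum_image (by
    intro a _ b _ hab; exact Finsupp.single_left_injective one_ne_zero hab)] at h4
  exact h4

/-- The block-diagonal matrix `(f_{ij})` with entries in `A`. -/
def blockMatrix (c : Fin r → ℝ) (f : Fin r → Fin r → A) : blockSubalgebra c ⊗[ℂ] A :=
  ∑ i, ∑ j, if h : c i = c j then
    (⟨_, single_mem_blockSubalgebra h⟩ : blockSubalgebra c) ⊗ₜ f i j else 0

theorem currentOp_blockMatrix_X (c : Fin r → ℝ) (f : Fin r → Fin r → A) (j : Fin r) :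
    currentOp (subDer (blockSubalgebra c)) A (blockMatrix c f) (MvPolynomial.X j ⊗ₜ 1) =
      ∑ i with c i = c j, MvPolynomial.X i ⊗ₜ f i j := by
  simp only [blockMatrix, map_sum, LinearMap.sum_apply]
  rw [Finset.sum_filter]
  refine Finset.sum_congr rfl fun i _ => ?_
  rw [Finset.sum_eq_single j]
  · split_ifs with hij
    · simp [subDer_apply, glDer_X, Matrix.single_apply, ite_smul]
    · simp
  · intro l _ hl
    split_ifs with hil
    · simp [subDer_apply, glDer_X, hl]
    · simp
  · simp

/-- The superderivations of `ℂ[t_1, …, t_r] ⊗ A` that commute with the Euler operators of the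
blocks come from `Der A ⋉ (k ⊗ A)`, where `k` is the algebra of block-diagonal matrices. -/
theorem exists_eq_of_comm_blockEuler (c : Fin r → ℝ)
    {T : Module.End ℂ (MvPolynomial (Fin r) ℂ ⊗[ℂ] A)}
    (hTd : T ∈ superDerSubmodule (MvPolynomial (Fin r) ℂ ⊗[ℂ] A))
    (hT : ∀ j x, LinearMap.rTensor A (blockEuler c j).toLinearMap (T x) =
      T (LinearMap.rTensor A (blockEuler c j).toLinearMap x)) :
    ∃ D ∈ superDerSubmodule A, ∃ u : blockSubalgebra c ⊗[ℂ] A,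
      T = LinearMap.lTensor (MvPolynomial (Fin r) ℂ) D +
        currentOp (subDer (blockSubalgebra c)) A u := by
  have hD := restrictOp_mem_superDer (MvPolynomial.lcoeff ℂ 0) hTd
  -- The derivation part is the constant coefficient of `T` on `1 ⊗ A`; the matrix entries are the
  -- coefficients of `t_i` in `T t_j`. Equality need only be checked on `1 ⊗ A` and on the
  -- variables.
  refine ⟨_, hD, blockMatrix c fun i j =>
    coeffA A (Finsupp.single i 1) (T (MvPolynomial.X j ⊗ₜ 1)), ?_⟩
  refine superDer_ext hTd (Submodule.add_mem _
    (lTensor_mem_superDer hD) (currentOp_mem_superDer _ _)) (fun a => ?_) (fun j => ?_)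
  · rw [LinearMap.add_apply, currentOp_one_tmul, add_zero, LinearMap.lTensor_tmul]
    refine eq_one_tmul_of_blockEuler c fun j => ?_
    -- Elements `1 ⊗ a` are killed by the block Euler operators, and `T` commutes with these, so `T
    -- (1 ⊗ a)` is killed too.
    rw [hT, LinearMap.rTensor_tmul, Derivation.coeFn_coe, Derivation.map_one_eq_zero,
      TensorProduct.zero_tmul, map_zero]
  · rw [LinearMap.add_apply, LinearMap.lTensor_tmul, superDer_one hD, TensorProduct.tmul_zero,
      zero_add, currentOp_blockMatrix_X]
    refine eq_sum_X_tmul_of_blockEuler c j fun l => ?_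
    -- Likewise `T t_j` inherits the block eigenvalues of `t_j`.
    rw [hT, LinearMap.rTensor_tmul, Derivation.coeFn_coe, blockEuler_X,
      ← TensorProduct.smul_tmul', map_smul]

end Gl

end

/-! ### Finite dimension of the exterior algebra -/

section FiniteExterior

/-- The exterior powers above degree `n` vanish, and the remaining ones are finitely many and
finite-dimensional. -/
instance finite_exteriorAlgebra (n : ℕ) :
    Module.Finite ℂ (ExteriorAlgebra ℂ (Fin n → ℂ)) := by
  have hbot : ∀ k, n < k → ⋀[ℂ]^k (Fin n → ℂ) = ⊥ := by
    intro k hk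
    rw [← Submodule.finrank_eq_zero (R := ℂ), exteriorPower.finrank_eq, Module.finrank_fin_fun,
      Nat.choose_eq_zero_of_lt hk]
  have htop : ⨆ k, ⋀[ℂ]^k (Fin n → ℂ) = ⊤ :=
    (DirectSum.Decomposition.isInternal
      (fun k => ⋀[ℂ]^k (Fin n → ℂ))).submodule_iSup_eq_top
  have hfin : ⨆ k : Fin (n + 1), ⋀[ℂ]^(k : ℕ) (Fin n → ℂ) = ⊤ := by
    rw [eq_top_iff, ← htop]
    refine iSup_le fun k => ?_
    by_cases hk : k < n + 1
    · exact le_iSup (fun k : Fin (n + 1) => ⋀[ℂ]^(k : ℕ) (Fin n → ℂ)) ⟨k, hk⟩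
    · rw [hbot k (by omega)]; exact bot_le
  refine ⟨?_⟩
  rw [← hfin]
  exact Submodule.fg_iSup _ fun k => Module.Finite.iff_fg.1 inferInstance

end FiniteExterior

/-! ### Spanning by weight vectors -/

section WeightDecomposition

variable {q : ℕ} {A : Type*} [Ring A] [Algebra ℂ A] [SuperCommAlgebra A]

omit [SuperCommAlgebra A] in
theorem span_weight_elements :
    Submodule.span ℂ {f : MvPolynomial (Fin q) ℂ ⊗[ℂ] A | ∃ β : Fin q → ℤ, ∀ i,
      LinearMap.rTensor A (polyEuler q i).toLinearMap f = (β i : ℂ) • f} = ⊤ := by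
  rw [eq_top_iff]
  intro x _
  obtain ⟨S, hS⟩ := exists_coeffA_eq_zero x
  rw [eq_sum_coeffA hS]
  refine Submodule.sum_mem _ fun β _ => Submodule.subset_span ⟨fun i => (β i : ℤ), fun i => ?_⟩
  rw [LinearMap.rTensor_tmul, Derivation.coeFn_coe, polyEuler_monomial, ← TensorProduct.smul_tmul']
  simp

omit [SuperCommAlgebra A] in
-- The exponents occurring for a finite spanning set of `A` bound those for all of `A`. Without
-- finiteness, the expansion of a superderivation by degree could be an infinite sum.
theorem exists_common_coeffA_eq_zero [Module.Finite ℂ A]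
    (g : A →ₗ[ℂ] MvPolynomial (Fin q) ℂ ⊗[ℂ] A) :
    ∃ S : Finset (Fin q →₀ ℕ), ∀ a, ∀ β ∉ S, coeffA A β (g a) = 0 := by
  classical
  obtain ⟨s, hs⟩ := (Module.finite_def (R := ℂ) (M := A)).1 inferInstance
  choose S hS using fun a => exists_coeffA_eq_zero (g a)
  refine ⟨s.biUnion S, fun a β hβ => ?_⟩
  have ha : a ∈ Submodule.span ℂ (s : Set A) := hs ▸ Submodule.mem_top
  induction ha using Submodule.span_induction with
  | mem x hx => exact hS x β fun h => hβ (Finset.mem_biUnion.2 ⟨x, hx, h⟩)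
  | zero => simp
  | add x y _ _ hx hy => rw [map_add, map_add, hx, hy, add_zero]
  | smul c x _ hx => rw [map_smul, map_smul, hx, smul_zero]

/-- The vector field `t^β ∂/∂t_i` has weight `β - ε_i`; both sides of the commutator identity are
derivations, so the variables suffice. -/
theorem polyEuler_comm_monomial_pderiv (i l : Fin q) (β : Fin q →₀ ℕ)
    (p : MvPolynomial (Fin q) ℂ) :
    polyEuler q l ((MvPolynomial.monomial β (1 : ℂ) • MvPolynomial.pderiv i :
      Derivation ℂ (MvPolynomial (Fin q) ℂ) (MvPolynomial (Fin q) ℂ)) p) =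
    (MvPolynomial.monomial β (1 : ℂ) • MvPolynomial.pderiv i :
      Derivation ℂ (MvPolynomial (Fin q) ℂ) (MvPolynomial (Fin q) ℂ)) (polyEuler q l p) +
    (((β l : ℤ) - if l = i then 1 else 0 : ℤ) : ℂ) •
      (MvPolynomial.monomial β (1 : ℂ) • MvPolynomial.pderiv i :
      Derivation ℂ (MvPolynomial (Fin q) ℂ) (MvPolynomial (Fin q) ℂ)) p := by
  generalize hδ : (MvPolynomial.monomial β (1 : ℂ) • MvPolynomial.pderiv i :
    Derivation ℂ (MvPolynomial (Fin q) ℂ) (MvPolynomial (Fin q) ℂ)) = δ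
  have hX : ∀ j, δ (MvPolynomial.X j) = if i = j then MvPolynomial.monomial β 1 else 0 := by
    intro j
    rw [← hδ, Derivation.smul_apply, MvPolynomial.pderiv_X]
    split_ifs with h
    · subst h; simp
    · rw [Pi.single_eq_of_ne (Ne.symm h), smul_zero]
  have key : ⁅polyEuler q l, δ⁆ = (((β l : ℤ) - if l = i then 1 else 0 : ℤ) : ℂ) • δ := by
    apply MvPolynomial.derivation_ext
    intro j
    rw [Derivation.commutator_apply, Derivation.smul_apply, polyEuler_X, hX]
    clear hδ
    by_cases hij : i = j
    · subst hij
      by_cases hl : l = i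
      · simp [hl, polyEuler_monomial, hX, sub_smul]
      · simp [hl, polyEuler_monomial]
    · by_cases hl : l = j
      · subst hl; simp [hij, hX]
      · simp [hij, hl]
  have h := congrArg (fun d : Derivation ℂ (MvPolynomial (Fin q) ℂ) (MvPolynomial (Fin q) ℂ) => d p)
    key
  simp only [Derivation.commutator_apply, Derivation.smul_apply] at h
  rw [← h]
  abel

/-- Expanding the values on the variables and on `A` in monomials writes `T` as a finite sum of
terms `t^β ∂/∂t_i ⊗ f` and `t^β ⊗ D`, of weights `β - ε_i` and `β`. -/
theorem span_weight_superDer [Module.Finite ℂ A] :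
    Submodule.span ℂ {T : SuperDer (MvPolynomial (Fin q) ℂ ⊗[ℂ] A) | ∃ α : Fin q → ℤ, ∀ i x,
      LinearMap.rTensor A (polyEuler q i).toLinearMap (derToEnd _ T x) =
        derToEnd _ T (LinearMap.rTensor A (polyEuler q i).toLinearMap x) +
          (α i : ℂ) • derToEnd _ T x} = ⊤ := by
  rw [eq_top_iff]
  intro T _
  obtain ⟨S, hS⟩ := exists_common_coeffA_eq_zero
    (derToEnd _ T ∘ₗ TensorProduct.mk ℂ (MvPolynomial (Fin q) ℂ) A 1)
  choose S' hS' using fun j => exists_coeffA_eq_zero (derToEnd _ T (MvPolynomial.X j ⊗ₜ 1))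
  let U : Fin q → (Fin q →₀ ℕ) → SuperDer (MvPolynomial (Fin q) ℂ ⊗[ℂ] A) := fun i β =>
    ⟨_, map_derivation_mulLeft_mem_superDer (MvPolynomial.monomial β (1 : ℂ) •
      MvPolynomial.pderiv i) (coeffA A β (derToEnd _ T (MvPolynomial.X i ⊗ₜ 1)))⟩
  let V : (Fin q →₀ ℕ) → SuperDer (MvPolynomial (Fin q) ℂ ⊗[ℂ] A) := fun β =>
    ⟨_, map_mulLeft_derivation_mem_superDer (MvPolynomial.monomial β (1 : ℂ))
      (restrictOp_mem_superDer (MvPolynomial.lcoeff ℂ β) (derToEnd_mem T))⟩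
  have hU : ∀ i β p a, derToEnd _ (U i β) (p ⊗ₜ a) =
      (MvPolynomial.monomial β (1 : ℂ) * MvPolynomial.pderiv i p) ⊗ₜ
        (coeffA A β (derToEnd _ T (MvPolynomial.X i ⊗ₜ 1)) * a) := fun i β p a => rfl
  have hV : ∀ β p a, derToEnd _ (V β) (p ⊗ₜ a) =
      (MvPolynomial.monomial β (1 : ℂ) * p) ⊗ₜ coeffA A β (derToEnd _ T (1 ⊗ₜ a)) :=
    fun β p a => rfl
  -- On `1 ⊗ A` only the `V β` act. On a variable `t_j` they vanish, because superderivations kill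
  -- `1`, and among the `U i β` only `i = j` contributes.
  have hT : T = (∑ i, ∑ β ∈ S' i, U i β) + ∑ β ∈ S, V β := by
    refine derToEnd_injective ?_
    refine superDer_ext (derToEnd_mem _) (derToEnd_mem _) (fun a => ?_) (fun j => ?_)
    · simp only [map_add, map_sum, LinearMap.add_apply, LinearMap.sum_apply, hU, hV]
      simp only [Derivation.map_one_eq_zero, mul_zero, TensorProduct.zero_tmul,
        Finset.sum_const_zero, zero_add, mul_one]
      exact eq_sum_coeffA (hS a)
    · simp only [map_add, map_sum, LinearMap.add_apply, LinearMap.sum_apply, hU, hV]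
      have h1 : derToEnd _ T ((1 : MvPolynomial (Fin q) ℂ) ⊗ₜ[ℂ] (1 : A)) = 0 :=
        superDer_one (derToEnd_mem T)
      rw [h1]
      simp only [map_zero, TensorProduct.tmul_zero, Finset.sum_const_zero, add_zero, mul_one]
      rw [Finset.sum_eq_single j]
      · simp only [MvPolynomial.pderiv_X_self, mul_one]
        exact eq_sum_coeffA (hS' j)
      · intro i _ hij
        simp [MvPolynomial.pderiv_X_of_ne (Ne.symm hij)]
      · simp
  rw [hT]
  refine Submodule.add_mem _ (Submodule.sum_mem _ fun i _ => Submodule.sum_mem _ fun β _ =>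
    Submodule.subset_span ⟨fun l => (β l : ℤ) - if l = i then 1 else 0, fun l x => ?_⟩)
    (Submodule.sum_mem _ fun β _ => Submodule.subset_span ⟨fun l => β l, fun l x => ?_⟩)
  · induction x with
    | zero => simp
    | add x y hx hy => simp only [map_add, hx, hy, smul_add]; abel
    | tmul p a =>
      have h := polyEuler_comm_monomial_pderiv i l β p
      simp only [Derivation.smul_apply, smul_eq_mul] at h
      rw [LinearMap.rTensor_tmul, hU, hU, LinearMap.rTensor_tmul, Derivation.coeFn_coe, h,
        TensorProduct.add_tmul, TensorProduct.smul_tmul']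
  · induction x with
    | zero => simp
    | add x y hx hy => simp only [map_add, hx, hy, smul_add]; abel
    | tmul p a =>
      rw [LinearMap.rTensor_tmul, hV, hV, LinearMap.rTensor_tmul, Derivation.coeFn_coe,
        Derivation.leibniz, polyEuler_monomial, TensorProduct.add_tmul, TensorProduct.smul_tmul']
      simp [mul_comm]

end WeightDecomposition

/-! ### Parabolic decompositions defined by a linear functional -/

section ParabolicOfFunctional

variable {E : Type*} [AddCommGroup E] [Module ℝ E]

/-- Nonnegative combinations of vectors with `f > 0` are zero or again have `f > 0`. Applied to `g`
and `-g`, it makes two opposite cones meet only in zero. -/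
theorem pos_or_eq_zero_of_mem_cone {F : Type*} [AddCommGroup F] [Module ℝ F] (f : F →ₗ[ℝ] ℝ)
    {S : Set F} (hS : ∀ x ∈ S, 0 < f x) {x : F} (hx : x ∈ Submodule.span ℝ≥0 S) :
    x = 0 ∨ 0 < f x := by
  induction hx using Submodule.span_induction with
  | mem x hx => exact Or.inr (hS x hx)
  | zero => exact Or.inl rfl
  | add x y _ _ hx hy =>
    rcases hx with rfl | hx
    · simpa using hy
    · rcases hy with rfl | hy
      · right; simpa using hx
      · right; rw [map_add]; exact add_pos hx hy
  | smul a x _ hx =>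
    rcases hx with rfl | hx
    · left; simp
    · rcases eq_or_ne a 0 with rfl | ha
      · left; simp
      · right
        rw [NNReal.smul_def, map_smul, smul_eq_mul]
        exact mul_pos (NNReal.coe_pos.2 (pos_iff_ne_zero.2 ha)) hx

/-- A linear functional `f` subdivides any set into the parts where it is positive, zero and
negative. -/
theorem isParabolicDecomp_of_functional (f : E →ₗ[ℝ] ℝ) (D : Set E) :
    IsParabolicDecomp D {x ∈ D | 0 < f x} {x ∈ D | f x = 0} {x ∈ D | f x < 0} := by
  set Z := {x ∈ D | f x = 0}
  -- The functional vanishes on `Z`, so it descends to a functional `g` on the quotient and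
  -- separates the images of the two parts there.
  have hZ : Submodule.span ℝ Z ≤ LinearMap.ker f :=
    Submodule.span_le.2 fun x hx => hx.2
  set g := (Submodule.span ℝ Z).liftQ f hZ
  have hg : ∀ x, g ((Submodule.span ℝ Z).mkQ x) = f x := fun x => rfl
  refine ⟨?_, ?_, ?_, ?_, ?_, ?_, ?_, ?_, ?_⟩
  · ext x
    constructor
    · rintro ((h | h) | h) <;> exact h.1
    · intro h
      rcases lt_trichotomy (f x) 0 with h' | h' | h'
      · exact Or.inr ⟨h, h'⟩
      · exact Or.inl (Or.inr ⟨h, h'⟩)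
      · exact Or.inl (Or.inl ⟨h, h'⟩)
  · rw [Set.disjoint_left]; rintro x ⟨_, h⟩ ⟨_, h'⟩; linarith
  · rw [Set.disjoint_left]; rintro x ⟨_, h⟩ ⟨_, h'⟩; linarith
  · rw [Set.disjoint_left]; rintro x ⟨_, h⟩ ⟨_, h'⟩; linarith
  · rintro ⟨x, ⟨_, h⟩, hx⟩
    rw [← hg, hx, map_zero] at h
    exact lt_irrefl _ h
  · rintro ⟨x, ⟨_, h⟩, hx⟩
    rw [← hg, hx, map_zero] at h
    exact lt_irrefl _ h
  · rw [← Set.image_union]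
    congr 1
    ext x
    constructor
    · rintro (⟨h, h'⟩ | ⟨h, h'⟩)
      · exact ⟨h, fun hz => h'.ne' hz.2⟩
      · exact ⟨h, fun hz => h'.ne hz.2⟩
    · rintro ⟨h, h'⟩
      rcases lt_trichotomy (f x) 0 with h1 | h1 | h1
      · exact Or.inr ⟨h, h1⟩
      · exact absurd ⟨h, h1⟩ h'
      · exact Or.inl ⟨h, h1⟩
  · rw [Set.disjoint_left]
    rintro _ ⟨x, ⟨_, h⟩, rfl⟩ ⟨y, ⟨_, h'⟩, hy⟩
    rw [← hg] at h h'
    rw [hy] at h'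
    linarith
  · rw [eq_bot_iff]
    rintro x ⟨h1, h2⟩
    have h1' := pos_or_eq_zero_of_mem_cone (-g) (by
      rintro y (⟨z, ⟨_, hz⟩, hy⟩ | ⟨z, ⟨_, hz⟩, rfl⟩)
      · rw [← hg, hy, map_neg] at hz; simpa using hz
      · rw [← hg] at hz; simpa using hz) h1
    have h2' := pos_or_eq_zero_of_mem_cone g (by
      rintro y (⟨z, ⟨_, hz⟩, hy⟩ | ⟨z, ⟨_, hz⟩, rfl⟩)
      · rw [← hg, hy, map_neg] at hz; simpa using hz
      · exact hz) h2
    rcases h1' with h | h1'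
    · exact h
    · rcases h2' with h | h2'
      · exact h
      · rw [LinearMap.neg_apply] at h1'; linarith

end ParabolicOfFunctional

section

attribute [local instance] LieRing.ofAssociativeRing

/-! ### Block-diagonal matrices form a Levi subalgebra -/

section LeviOfGl

variable {r : ℕ}

/-- The weight `α` need not be a root: it may be zero, which is covered by the centralizer term, or
its weight space may vanish. -/
theorem wtSpace_le_leviSpace {m : ℕ} {V : Type*} [AddCommGroup V] [Module ℂ V]
    (T : Fin m → Module.End ℂ V) {S : Set (Fin m → ℂ)} {Z : Set (Fin m → ℂ)}
    (hZ : roots T ∩ S ⊆ Z) {α : Fin m → ℂ} (hα : α ∈ S) : wtSpace T α ≤ leviSpace T Z := by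
  by_cases h0 : α = 0
  · rw [h0]; exact le_sup_left
  by_cases hb : wtSpace T α = ⊥
  · rw [hb]; exact bot_le
  · exact (le_iSup₂ (f := fun α (_ : α ∈ Z) => wtSpace T α) α (hZ ⟨⟨hb, h0⟩, hα⟩)).trans
      le_sup_right

theorem mem_wtSpace {m : ℕ} {V : Type*} [AddCommGroup V] [Module ℂ V]
    {T : Fin m → Module.End ℂ V} {α : Fin m → ℂ} {v : V} :
    v ∈ wtSpace T α ↔ ∀ i, T i v = α i • v := by
  simp [wtSpace]

theorem glCartan_apply (l : Fin r) (x : Matrix (Fin r) (Fin r) ℂ) (i j : Fin r) :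
    glCartan r l x i j = ((eps i - eps j : Fin r → ℂ) l) * x i j := by
  rw [glCartan, LieAlgebra.ad_apply, LieRing.of_associative_ring_bracket, Matrix.sub_apply,
    Matrix.mul_apply, Matrix.mul_apply, Pi.sub_apply, eps, eps, sub_mul, Pi.single_apply,
    Pi.single_apply]
  simp only [Matrix.single_apply, ite_and, ite_mul, mul_ite, one_mul, zero_mul, mul_one, mul_zero,
    Finset.sum_ite_irrel, Finset.sum_const_zero, Finset.sum_ite_eq, Finset.mem_univ, if_true]
  congr 1
  all_goals
    split_ifs with h
    · rw [h]
    · rfl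

theorem eq_of_mem_wtSpace_glCartan {x : Matrix (Fin r) (Fin r) ℂ} {α : Fin r → ℂ}
    (hx : x ∈ wtSpace (glCartan r) α) {i j : Fin r} (h : x i j ≠ 0) : α = eps i - eps j := by
  ext l
  have h1 := congrFun (congrFun (mem_wtSpace.1 hx l) i) j
  rw [glCartan_apply, Matrix.smul_apply, smul_eq_mul] at h1
  exact (mul_right_cancel₀ h h1).symm

theorem single_mem_wtSpace (i j : Fin r) :
    Matrix.single i j (1 : ℂ) ∈ wtSpace (glCartan r) (eps i - eps j) := by
  refine mem_wtSpace.2 fun l => ?_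
  ext a b
  rw [glCartan_apply, Matrix.smul_apply, smul_eq_mul, Matrix.single_apply]
  split_ifs with h
  · rw [h.1, h.2]
  · simp

/-- The functional `v ↦ ∑ c_i Re v_i`. -/
def reFunctional (c : Fin r → ℝ) : (Fin r → ℂ) →ₗ[ℝ] ℝ :=
  ∑ i, c i • (Complex.reLm ∘ₗ LinearMap.proj i)

theorem reFunctional_eps_sub (c : Fin r → ℝ) (i j : Fin r) :
    reFunctional c (eps i - eps j) = c i - c j := by
  simp [reFunctional, eps, Pi.single_apply, mul_sub, Finset.sum_sub_distrib, apply_ite Complex.re]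

/-- The functional `∑ c_i Re v_i` takes the value `c_i - c_j` on `ε_i - ε_j`. Its zero part
therefore consists of the roots within blocks; this is why blocks are labelled by real numbers. -/
theorem isLeviOfGl_blockSubalgebra (c : Fin r → ℝ) : IsLeviOfGl (blockSubalgebra c) := by
  refine ⟨_, _, _, isParabolicDecomp_of_functional (reFunctional c) (roots (glCartan r)), ?_⟩
  apply le_antisymm
  · intro x hx
    rw [Matrix.matrix_eq_sum_single x]
    refine Submodule.sum_mem _ fun i _ => Submodule.sum_mem _ fun j _ => ?_
    by_cases hij : c i = c j
    · have : Matrix.single i j (x i j) = x i j • Matrix.single i j 1 := by simp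
      rw [this]
      refine Submodule.smul_mem _ _ (wtSpace_le_leviSpace (S := {α | reFunctional c α = 0}) _ ?_ ?_
        (single_mem_wtSpace i j))
      · exact fun _ h => h
      · rw [Set.mem_ofPred_eq, reFunctional_eps_sub, hij, sub_self]
    · rw [hx i j hij, Matrix.single_zero]
      exact Submodule.zero_mem _
  · refine sup_le ?_ (iSup₂_le fun α hα => ?_)
    · intro x hx i j hij
      by_contra h
      have h1 := congrArg (reFunctional c) (eq_of_mem_wtSpace_glCartan hx h)
      rw [map_zero, reFunctional_eps_sub] at h1
      exact hij (sub_eq_zero.1 h1.symm)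
    · intro x hx i j hij
      by_contra h
      have h1 := congrArg (reFunctional c) (eq_of_mem_wtSpace_glCartan hx h)
      rw [hα.2, reFunctional_eps_sub] at h1
      exact hij (sub_eq_zero.1 h1.symm)

end LeviOfGl

end

/-- The composition of homomorphisms of Lie superalgebras. -/
def LieSuperHom.comp {L L' L'' : Type*} [AddCommGroup L] [Module ℂ L] [LieSuperalgebra L]
    [AddCommGroup L'] [Module ℂ L'] [LieSuperalgebra L'] [AddCommGroup L''] [Module ℂ L'']
    [LieSuperalgebra L''] (g : LieSuperHom L' L'') (f : LieSuperHom L L') : LieSuperHom L L'' where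
  toLin := g.toLin ∘ₗ f.toLin
  map_par h := g.map_par (f.map_par h)
  map_br x y := by simp only [LinearMap.comp_apply, f.map_br, g.map_br]

/-! ### Transport of superderivations along an algebra isomorphism -/

section Conj

variable {B C : Type*} [Ring B] [Algebra ℂ B] [SuperCommAlgebra B] [Ring C] [Algebra ℂ C]
  [SuperCommAlgebra C] (Ψ : B ≃ₐ[ℂ] C) (hΨ : ∀ i, ∀ b ∈ par (V := B) i, Ψ b ∈ par (V := C) i)

include hΨ in
-- Split the preimage into parities. The component of the wrong parity has an image lying in both
-- parity subspaces of `C`, so it is zero.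
theorem symm_mem_par {i : ZMod 2} {c : C} (hc : c ∈ par (V := C) i) :
    Ψ.symm c ∈ par (V := B) i := by
  have hd := Submodule.disjoint_def.1 (SuperSpace.isCompl (V := C)).disjoint
  have h := even_add_odd (Ψ.symm c)
  have h2 : c = Ψ (evenProj B (Ψ.symm c)) + Ψ (oddProj B (Ψ.symm c)) := by
    rw [← map_add, h, AlgEquiv.apply_symm_apply]
  have he := hΨ 0 _ (evenProj_mem (Ψ.symm c))
  have ho := hΨ 1 _ (oddProj_mem (Ψ.symm c))
  rcases zmod_cases i with rfl | rfl
  · have h3 : Ψ (oddProj B (Ψ.symm c)) ∈ par (V := C) 0 := by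
      exact (Submodule.add_mem_iff_right _ he).1 (by rwa [← h2])
    have h4 := hd _ h3 ho
    rw [EmbeddingLike.map_eq_zero_iff] at h4
    rw [← h, h4, add_zero]
    exact evenProj_mem _
  · have h3 : Ψ (evenProj B (Ψ.symm c)) ∈ par (V := C) 1 := by
      exact (Submodule.add_mem_iff_left _ ho).1 (by rwa [← h2])
    have h4 := hd _ he h3
    rw [EmbeddingLike.map_eq_zero_iff] at h4
    rw [← h, h4, zero_add]
    exact oddProj_mem _

/-- Conjugation of operators by an isomorphism. -/
def conjEnd : Module.End ℂ B →ₗ[ℂ] Module.End ℂ C := Ψ.toLinearEquiv.conj.toLinearMap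

omit [SuperCommAlgebra B] [SuperCommAlgebra C] in
theorem conjEnd_apply (T : Module.End ℂ B) (c : C) : conjEnd Ψ T c = Ψ (T (Ψ.symm c)) := rfl

include hΨ in
theorem conjEnd_mem_derPar {i : ZMod 2} {T : Module.End ℂ B} (hT : T ∈ derPar B i) :
    conjEnd Ψ T ∈ derPar C i := by
  refine ⟨fun j v hv => hΨ _ _ (hT.1 j _ (symm_mem_par Ψ hΨ hv)), fun j a ha b => ?_⟩
  simp only [conjEnd_apply, map_mul, hT.2 j _ (symm_mem_par Ψ hΨ ha), map_add, map_smul,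
    AlgEquiv.apply_symm_apply]

include hΨ in
theorem conjEnd_mem_superDer {T : Module.End ℂ B} (hT : T ∈ superDerSubmodule B) :
    conjEnd Ψ T ∈ superDerSubmodule C := by
  obtain ⟨T0, h0, T1, h1, rfl⟩ := Submodule.mem_sup.1 hT
  rw [map_add]
  exact Submodule.add_mem _ (derPar_le 0 (conjEnd_mem_derPar Ψ hΨ h0))
    (derPar_le 1 (conjEnd_mem_derPar Ψ hΨ h1))

/-- The linear map underlying `superDerConj`. -/
def superDerConjLin : SuperDer B →ₗ[ℂ] SuperDer C :=
  LinearMap.codRestrict (superDerSubmodule C) (conjEnd Ψ ∘ₗ derToEnd B)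
    fun T => conjEnd_mem_superDer Ψ hΨ T.2

/-- The isomorphism of superderivation algebras induced by an isomorphism of superalgebras. -/
def superDerConj : LieSuperHom (SuperDer B) (SuperDer C) where
  toLin := superDerConjLin Ψ hΨ
  map_par h := conjEnd_mem_derPar Ψ hΨ h
  map_br := map_br_of_homogeneous (L := SuperDer B) (L' := SuperDer C) _ <| by
    intro i j D E hD hE
    have hD' : derToEnd B D ∈ derPar B i := hD
    have hE' : derToEnd B E ∈ derPar B j := hE
    refine derToEnd_injective ?_
    change conjEnd Ψ (superComm B (derToEnd B D) (derToEnd B E)) =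
      superComm C (conjEnd Ψ (derToEnd B D)) (conjEnd Ψ (derToEnd B E))
    rw [superComm_apply hD'.1 hE'.1, superComm_apply (conjEnd_mem_derPar Ψ hΨ hD').1
      (conjEnd_mem_derPar Ψ hΨ hE').1]
    ext c
    simp [conjEnd_apply]

include hΨ in
theorem exists_conj {T : Module.End ℂ C} (hT : T ∈ superDerSubmodule C) :
    ∃ T' ∈ superDerSubmodule B, ∀ b, Ψ (T' b) = T (Ψ b) := by
  refine ⟨_, conjEnd_mem_superDer Ψ.symm (fun i c hc => symm_mem_par Ψ hΨ hc) hT, fun b => ?_⟩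
  rw [conjEnd_apply, AlgEquiv.symm_symm, AlgEquiv.apply_symm_apply]

end Conj

/-! ### Splitting the variables into two groups -/

section Split

variable {q r m : ℕ} (e : Fin r ⊕ Fin q ≃ Fin m) (A : Type*) [Ring A] [Algebra ℂ A]

/-- Splitting the variables of a polynomial ring into two groups. -/
def polySplit : MvPolynomial (Fin r) ℂ ⊗[ℂ] MvPolynomial (Fin q) ℂ ≃ₐ[ℂ] MvPolynomial (Fin m) ℂ :=
  (MvPolynomial.tensorEquivSum ℂ (Fin r) (Fin q) ℂ).trans (MvPolynomial.renameEquiv ℂ e)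

theorem polySplit_tmul (p : MvPolynomial (Fin r) ℂ) (s : MvPolynomial (Fin q) ℂ) :
    polySplit e (p ⊗ₜ s) =
      MvPolynomial.rename (e ∘ Sum.inl) p * MvPolynomial.rename (e ∘ Sum.inr) s := by
  have h : (polySplit e).toAlgHom = Algebra.TensorProduct.productMap
      (MvPolynomial.rename (e ∘ Sum.inl)) (MvPolynomial.rename (e ∘ Sum.inr)) := by
    apply Algebra.TensorProduct.ext
    · apply MvPolynomial.algHom_ext
      intro i
      simp [polySplit]
    · apply MvPolynomial.algHom_ext
      intro i
      simp [polySplit]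
  have h2 := DFunLike.congr_fun h (p ⊗ₜ s)
  simpa using h2

/-- The isomorphism `ℂ[t_1, …, t_r] ⊗ (ℂ[t_1, …, t_q] ⊗ A) ≃ ℂ[t_1, …, t_m] ⊗ A`. -/
def splitEquiv : MvPolynomial (Fin r) ℂ ⊗[ℂ] (MvPolynomial (Fin q) ℂ ⊗[ℂ] A) ≃ₐ[ℂ]
    MvPolynomial (Fin m) ℂ ⊗[ℂ] A :=
  (Algebra.TensorProduct.assoc ℂ ℂ ℂ (MvPolynomial (Fin r) ℂ) (MvPolynomial (Fin q) ℂ) A).symm.trans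
    (Algebra.TensorProduct.congr (polySplit e) AlgEquiv.refl)

theorem splitEquiv_tmul (p : MvPolynomial (Fin r) ℂ) (s : MvPolynomial (Fin q) ℂ) (a : A) :
    splitEquiv e A (p ⊗ₜ (s ⊗ₜ a)) =
      (MvPolynomial.rename (e ∘ Sum.inl) p * MvPolynomial.rename (e ∘ Sum.inr) s) ⊗ₜ a := by
  rw [← polySplit_tmul]; rfl

theorem splitEquiv_mem_par [SuperCommAlgebra A] (i : ZMod 2)
    (x : MvPolynomial (Fin r) ℂ ⊗[ℂ] (MvPolynomial (Fin q) ℂ ⊗[ℂ] A))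
    (hx : x ∈ par (V := MvPolynomial (Fin r) ℂ ⊗[ℂ] (MvPolynomial (Fin q) ℂ ⊗[ℂ] A)) i) :
    splitEquiv e A x ∈ par (V := MvPolynomial (Fin m) ℂ ⊗[ℂ] A) i := by
  induction x, hx using tensor_par_induction with
  | zero => rw [map_zero]; exact Submodule.zero_mem _
  | add x y _ _ hx hy => rw [map_add]; exact Submodule.add_mem _ hx hy
  | tmul p y hy =>
    induction y, hy using tensor_par_induction with
    | zero => rw [TensorProduct.tmul_zero, map_zero]; exact Submodule.zero_mem _
    | add x y _ _ hx hy =>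
      rw [TensorProduct.tmul_add, map_add]; exact Submodule.add_mem _ hx hy
    | tmul s a ha => rw [splitEquiv_tmul]; exact tmul_mem_par _ ha

theorem polyEuler_rename {f : Fin r → Fin m} (hf : Function.Injective f) (a : Fin r)
    (p : MvPolynomial (Fin r) ℂ) :
    polyEuler m (f a) (MvPolynomial.rename f p) = MvPolynomial.rename f (polyEuler r a p) := by
  induction p using MvPolynomial.induction_on with
  | C c => simp [polyEuler]
  | add p s hp hs => simp only [map_add, hp, hs]
  | mul_X p i hp =>
    rw [map_mul, Derivation.leibniz, Derivation.leibniz, hp, MvPolynomial.rename_X, polyEuler_X,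
      polyEuler_X]
    simp only [hf.eq_iff, smul_eq_mul, map_add, map_mul, MvPolynomial.rename_X]
    split_ifs <;> simp

theorem polyEuler_rename_of_notMem {f : Fin r → Fin m} {j : Fin m} (hj : ∀ a, f a ≠ j)
    (p : MvPolynomial (Fin r) ℂ) : polyEuler m j (MvPolynomial.rename f p) = 0 := by
  induction p using MvPolynomial.induction_on with
  | C c => simp [polyEuler]
  | add p s hp hs => rw [map_add, map_add, hp, hs, add_zero]
  | mul_X p i hp =>
    rw [map_mul, Derivation.leibniz, hp, MvPolynomial.rename_X, polyEuler_X,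
      if_neg (hj i).symm, smul_zero, smul_zero, add_zero]

/-- A Euler operator of a variable in the first group acts on the first tensor factor only, since it
kills polynomials in the other group. -/
theorem rTensor_polyEuler_inl (b : Fin r)
    (x : MvPolynomial (Fin r) ℂ ⊗[ℂ] (MvPolynomial (Fin q) ℂ ⊗[ℂ] A)) :
    LinearMap.rTensor A (polyEuler m (e (Sum.inl b))).toLinearMap (splitEquiv e A x) =
      splitEquiv e A (LinearMap.rTensor _ (polyEuler r b).toLinearMap x) := by
  induction x with
  | zero => simp
  | add x y hx hy => simp only [map_add, hx, hy]
  | tmul p y =>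
    induction y with
    | zero => simp
    | add x y hx hy => simp only [TensorProduct.tmul_add, map_add, hx, hy]
    | tmul s a =>
      have h1 := polyEuler_rename (e.injective.comp Sum.inl_injective) b p
      have h2 := polyEuler_rename_of_notMem (f := e ∘ Sum.inr) (j := e (Sum.inl b))
        (fun a h => by simpa using e.injective h) s
      rw [Function.comp_apply] at h1
      rw [splitEquiv_tmul, LinearMap.rTensor_tmul, LinearMap.rTensor_tmul, splitEquiv_tmul,
        Derivation.coeFn_coe, Derivation.coeFn_coe, Derivation.leibniz, h1, h2, smul_zero,
        zero_add, smul_eq_mul, mul_comm]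

theorem rTensor_polyEuler_inr (b : Fin q)
    (x : MvPolynomial (Fin r) ℂ ⊗[ℂ] (MvPolynomial (Fin q) ℂ ⊗[ℂ] A)) :
    LinearMap.rTensor A (polyEuler m (e (Sum.inr b))).toLinearMap (splitEquiv e A x) =
      splitEquiv e A (LinearMap.lTensor _ (LinearMap.rTensor A (polyEuler q b).toLinearMap) x) := by
  induction x with
  | zero => simp
  | add x y hx hy => simp only [map_add, hx, hy]
  | tmul p y =>
    induction y with
    | zero => simp
    | add x y hx hy => simp only [TensorProduct.tmul_add, map_add, hx, hy]
    | tmul s a =>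
      have h1 := polyEuler_rename (e.injective.comp Sum.inr_injective) b s
      have h2 := polyEuler_rename_of_notMem (f := e ∘ Sum.inl) (j := e (Sum.inr b))
        (fun a h => by simpa using e.injective h) p
      rw [Function.comp_apply] at h1
      rw [splitEquiv_tmul, LinearMap.rTensor_tmul, LinearMap.lTensor_tmul, LinearMap.rTensor_tmul,
        splitEquiv_tmul, Derivation.coeFn_coe, Derivation.coeFn_coe, Derivation.leibniz, h1, h2,
        smul_zero, add_zero, smul_eq_mul]

end Split

section

attribute [local instance] LieRing.ofAssociativeRing

/-! ### The semidirect product inside `W_{m,n}` and the weights of its image -/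

section LeviHom

variable {q r m : ℕ} (e : Fin r ⊕ Fin q ≃ Fin m) (A : Type*) [Ring A] [Algebra ℂ A]
  [SuperCommAlgebra A] (c : Fin r → ℝ)

/-- The superderivation `T` of `ℂ[t_1, …, t_m] ⊗ A` has weight `α`. -/
def HasWeight {A : Type*} [Ring A] [Algebra ℂ A]
    (T : Module.End ℂ (MvPolynomial (Fin m) ℂ ⊗[ℂ] A)) (α : Fin m → ℂ) : Prop :=
  ∀ i x, LinearMap.rTensor A (polyEuler m i).toLinearMap (T x) =
    T (LinearMap.rTensor A (polyEuler m i).toLinearMap x) + α i • T x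

/-- The isomorphism of superderivation algebras induced by `splitEquiv`. -/
def splitDer : LieSuperHom (SuperDer (MvPolynomial (Fin r) ℂ ⊗[ℂ] (MvPolynomial (Fin q) ℂ ⊗[ℂ] A)))
    (SuperDer (MvPolynomial (Fin m) ℂ ⊗[ℂ] A)) :=
  superDerConj (B := MvPolynomial (Fin r) ℂ ⊗[ℂ] (MvPolynomial (Fin q) ℂ ⊗[ℂ] A))
    (C := MvPolynomial (Fin m) ℂ ⊗[ℂ] A) (splitEquiv e A) (splitEquiv_mem_par e A)

theorem derToEnd_splitDer
    (T : SuperDer (MvPolynomial (Fin r) ℂ ⊗[ℂ] (MvPolynomial (Fin q) ℂ ⊗[ℂ] A)))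
    (x : MvPolynomial (Fin r) ℂ ⊗[ℂ] (MvPolynomial (Fin q) ℂ ⊗[ℂ] A)) :
    derToEnd _ ((splitDer e A).toLin T) (splitEquiv e A x) = splitEquiv e A (derToEnd _ T x) := by
  have h : derToEnd _ ((splitDer e A).toLin T) (splitEquiv e A x) =
    splitEquiv e A (derToEnd _ T ((splitEquiv e A).symm (splitEquiv e A x))) := rfl
  rw [h, AlgEquiv.symm_apply_apply]

theorem splitDer_injective : Function.Injective (splitDer e A).toLin := by
  intro T T' h
  refine derToEnd_injective (LinearMap.ext fun x => (splitEquiv e A).injective ?_)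
  rw [← derToEnd_splitDer, h, derToEnd_splitDer]

theorem splitDer_surjective : Function.Surjective (splitDer e A).toLin := by
  intro T
  obtain ⟨T', hT', h⟩ := exists_conj (B := MvPolynomial (Fin r) ℂ ⊗[ℂ] (MvPolynomial (Fin q) ℂ ⊗[ℂ] A))
    (splitEquiv e A) (splitEquiv_mem_par e A) (derToEnd_mem T)
  refine ⟨⟨T', hT'⟩, derToEnd_injective (LinearMap.ext fun x => ?_)⟩
  obtain ⟨x, rfl⟩ := (splitEquiv e A).surjective x
  exact (derToEnd_splitDer e A _ x).trans (h x)

/-- The realization of `Der (ℂ[t_1, …, t_q] ⊗ A) ⋉ (k ⊗ ℂ[t_1, …, t_q] ⊗ A)` by superderivations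
of `ℂ[t_1, …, t_m] ⊗ A`, for the algebra `k ⊆ 𝔤𝔩_{m-q}` of block-diagonal matrices. -/
def leviHom : LieSuperHom
    (Semidirect (currentAction (blockSubalgebra c) (MvPolynomial (Fin q) ℂ ⊗[ℂ] A)))
    (SuperDer (MvPolynomial (Fin m) ℂ ⊗[ℂ] A)) :=
  (splitDer e A).comp
    (semidirectHom (subDer (blockSubalgebra c)) (MvPolynomial (Fin q) ℂ ⊗[ℂ] A))

theorem leviHom_injective : Function.Injective (leviHom e A c).toLin :=
  (splitDer_injective e A).comp (semidirectHom_injective _)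

theorem derToEnd_leviHom (D : SuperDer (MvPolynomial (Fin q) ℂ ⊗[ℂ] A))
    (u : blockSubalgebra c ⊗[ℂ] (MvPolynomial (Fin q) ℂ ⊗[ℂ] A))
    (x : MvPolynomial (Fin r) ℂ ⊗[ℂ] (MvPolynomial (Fin q) ℂ ⊗[ℂ] A)) :
    derToEnd _ ((leviHom e A c).toLin (D, u)) (splitEquiv e A x) =
      splitEquiv e A (LinearMap.lTensor (MvPolynomial (Fin r) ℂ) (derToEnd _ D) x +
        currentOp (subDer (blockSubalgebra c)) _ u x) :=
  derToEnd_splitDer e A _ x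

variable {A c} in
-- Transported through `splitEquiv`, the hypothesis says that `T` commutes with the block Euler
-- operators, so `exists_eq_of_comm_blockEuler` applies with coefficient algebra `ℂ[t_1, …, t_q] ⊗
-- A`.
theorem mem_range_leviHom {T : SuperDer (MvPolynomial (Fin m) ℂ ⊗[ℂ] A)}
    (hT : ∀ j x, ∑ i with c i = c j,
        LinearMap.rTensor A (polyEuler m (e (Sum.inl i))).toLinearMap (derToEnd _ T x) =
      derToEnd _ T (∑ i with c i = c j,
        LinearMap.rTensor A (polyEuler m (e (Sum.inl i))).toLinearMap x)) :
    T ∈ LinearMap.range (leviHom e A c).toLin := by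
  obtain ⟨T, rfl⟩ := splitDer_surjective e A T
  have hb : ∀ j (x : MvPolynomial (Fin r) ℂ ⊗[ℂ] (MvPolynomial (Fin q) ℂ ⊗[ℂ] A)),
      splitEquiv e A (LinearMap.rTensor _ (blockEuler c j).toLinearMap x) =
        ∑ i with c i = c j, LinearMap.rTensor A
          (polyEuler m (e (Sum.inl i))).toLinearMap (splitEquiv e A x) := by
    intro j x
    simp only [rTensor_polyEuler_inl, ← map_sum]
    congr 1
    induction x with
    | zero => simp
    | add x y hx hy => simp only [map_add, hx, hy, Finset.sum_add_distrib]
    | tmul p a =>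
      simp only [LinearMap.rTensor_tmul, Derivation.coeFn_coe, blockEuler_apply,
        TensorProduct.sum_tmul]
  obtain ⟨D, hD, u, h⟩ := exists_eq_of_comm_blockEuler c (derToEnd_mem T) (by
    intro j x
    apply (splitEquiv e A).injective
    have h := hT j (splitEquiv e A x)
    rw [derToEnd_splitDer, ← hb, ← hb, derToEnd_splitDer] at h
    exact h)
  refine ⟨((⟨D, hD⟩ : SuperDer (MvPolynomial (Fin q) ℂ ⊗[ℂ] A)), u), ?_⟩
  change (splitDer e A).toLin ((semidirectHom _ _).toLin _) = _
  congr 1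
  refine derToEnd_injective ?_
  exact (derToEnd_semidirectHom _ _ _).trans h.symm

variable {A} in
omit [SuperCommAlgebra A] in
theorem hasWeight_of_split
    {T : Module.End ℂ (MvPolynomial (Fin r) ℂ ⊗[ℂ] (MvPolynomial (Fin q) ℂ ⊗[ℂ] A))}
    {T' : Module.End ℂ (MvPolynomial (Fin m) ℂ ⊗[ℂ] A)} {α : Fin m → ℂ}
    (hT : ∀ x, T' (splitEquiv e A x) = splitEquiv e A (T x))
    (hl : ∀ i x, LinearMap.rTensor _ (polyEuler r i).toLinearMap (T x) =
      T (LinearMap.rTensor _ (polyEuler r i).toLinearMap x) + α (e (Sum.inl i)) • T x)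
    (hr : ∀ i x, LinearMap.lTensor _ (LinearMap.rTensor A (polyEuler q i).toLinearMap) (T x) =
      T (LinearMap.lTensor _ (LinearMap.rTensor A (polyEuler q i).toLinearMap) x) +
        α (e (Sum.inr i)) • T x) :
    HasWeight T' α := by
  intro i x
  obtain ⟨i, rfl⟩ := e.surjective i
  obtain ⟨x, rfl⟩ := (splitEquiv e A).surjective x
  rcases i with i | i
  · rw [hT, rTensor_polyEuler_inl, rTensor_polyEuler_inl, hT, hl, map_add, map_smul]
  · rw [hT, rTensor_polyEuler_inr, rTensor_polyEuler_inr, hT, hr, map_add, map_smul]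

/-- The weight `∑ α_a ε_a`, with integral `α`, supported on the second group of variables. -/
def extendWeight (α : Fin q → ℤ) : Fin m → ℂ := ∑ a, α a • eps (e (Sum.inr a))

theorem extendWeight_inl (α : Fin q → ℤ) (i : Fin r) : extendWeight e α (e (Sum.inl i)) = 0 := by
  simp [extendWeight, Finset.sum_apply, eps]

theorem extendWeight_inr (α : Fin q → ℤ) (i : Fin q) :
    extendWeight e α (e (Sum.inr i)) = α i := by
  simp [extendWeight, Finset.sum_apply, eps, Pi.single_apply]

theorem polyEuler_eq_glDer (i : Fin r) : polyEuler r i = glDer r (Matrix.single i i 1) := by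
  apply MvPolynomial.derivation_ext
  intro j
  rw [polyEuler_X, glDer_X]
  by_cases h : i = j
  · subst h; simp [Matrix.single_apply]
  · simp [h]

/-- Image under the Lie homomorphism `glDer` of the fact that the matrix unit `E_{ij}` has weight
`ε_i - ε_j`. -/
theorem polyEuler_glDer_single (i j l : Fin r) (p : MvPolynomial (Fin r) ℂ) :
    polyEuler r l (glDer r (Matrix.single i j 1) p) =
      glDer r (Matrix.single i j 1) (polyEuler r l p) +
        ((eps i - eps j : Fin r → ℂ) l) • glDer r (Matrix.single i j 1) p := by
  have h1 : ⁅Matrix.single l l (1 : ℂ), Matrix.single i j (1 : ℂ)⁆ =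
      ((eps i - eps j : Fin r → ℂ) l) • Matrix.single i j (1 : ℂ) :=
    mem_wtSpace.1 (single_mem_wtSpace i j) l
  have h2 := congrArg (glDer r) h1
  rw [LieHom.map_lie, ← polyEuler_eq_glDer, map_smul] at h2
  have h3 := congrArg (fun d : Derivation ℂ (MvPolynomial (Fin r) ℂ) (MvPolynomial (Fin r) ℂ) =>
    d p) h2
  simp only [Derivation.commutator_apply, Derivation.smul_apply] at h3
  rw [← h3]
  abel

theorem eps_inl_inl (i j : Fin r) : (eps (e (Sum.inl i)) : Fin m → ℂ) (e (Sum.inl j)) =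
    (eps i : Fin r → ℂ) j := by
  simp [eps, Pi.single_apply]

theorem eps_inl_inr (i : Fin r) (j : Fin q) :
    (eps (e (Sum.inl i)) : Fin m → ℂ) (e (Sum.inr j)) = 0 := by
  simp [eps]

variable {A} in
omit [SuperCommAlgebra A] in
theorem hasWeight_lTensor {T' : Module.End ℂ (MvPolynomial (Fin m) ℂ ⊗[ℂ] A)}
    {D : Module.End ℂ (MvPolynomial (Fin q) ℂ ⊗[ℂ] A)} {α : Fin q → ℤ}
    (hT : ∀ x, T' (splitEquiv e A x) =
      splitEquiv e A (LinearMap.lTensor (MvPolynomial (Fin r) ℂ) D x))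
    (hD : ∀ i x, LinearMap.rTensor A (polyEuler q i).toLinearMap (D x) =
      D (LinearMap.rTensor A (polyEuler q i).toLinearMap x) + (α i : ℂ) • D x) :
    HasWeight T' (extendWeight e α) := by
  refine hasWeight_of_split e hT (fun i x => ?_) (fun i x => ?_)
  · rw [extendWeight_inl, zero_smul, add_zero]
    induction x with
    | zero => simp
    | add x y hx hy => simp only [map_add, hx, hy]
    | tmul p a => simp
  · rw [extendWeight_inr]
    induction x with
    | zero => simp
    | add x y hx hy => simp only [map_add, hx, hy, smul_add]; abel
    | tmul p a =>
      simp only [LinearMap.lTensor_tmul, hD, TensorProduct.tmul_add, TensorProduct.tmul_smul]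

variable {A} in
omit [SuperCommAlgebra A] in
theorem hasWeight_map_glDer (i j : Fin r) {T' : Module.End ℂ (MvPolynomial (Fin m) ℂ ⊗[ℂ] A)}
    {f : MvPolynomial (Fin q) ℂ ⊗[ℂ] A} {β : Fin q → ℤ}
    (hT : ∀ x, T' (splitEquiv e A x) = splitEquiv e A (TensorProduct.map
      (glDer r (Matrix.single i j 1)).toLinearMap (LinearMap.mulLeft ℂ f) x))
    (hf : ∀ l, LinearMap.rTensor A (polyEuler q l).toLinearMap f = (β l : ℂ) • f) :
    HasWeight T' (eps (e (Sum.inl i)) - eps (e (Sum.inl j)) + extendWeight e β) := by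
  refine hasWeight_of_split e hT (fun l x => ?_) (fun l x => ?_)
  · rw [Pi.add_apply, Pi.sub_apply, extendWeight_inl, add_zero, eps_inl_inl, eps_inl_inl,
      ← Pi.sub_apply]
    induction x with
    | zero => simp
    | add x y hx hy => simp only [map_add, hx, hy, smul_add]; abel
    | tmul p a =>
      simp only [LinearMap.rTensor_tmul, TensorProduct.map_tmul, Derivation.coeFn_coe,
        polyEuler_glDer_single, TensorProduct.add_tmul, TensorProduct.smul_tmul']
  · rw [Pi.add_apply, Pi.sub_apply, extendWeight_inr, eps_inl_inr, eps_inl_inr, sub_zero, zero_add]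
    induction x with
    | zero => simp
    | add x y hx hy => simp only [map_add, hx, hy, smul_add]; abel
    | tmul p a =>
      simp only [LinearMap.lTensor_tmul, TensorProduct.map_tmul, Derivation.coeFn_coe,
        LinearMap.mulLeft_apply, rTensor_mul, hf, TensorProduct.tmul_add, smul_mul_assoc,
        TensorProduct.tmul_smul]
      abel

variable {e c} in
-- The image is spanned by two kinds of weight vectors: weight superderivations in the second group
-- of variables, and `E_{ij} ⊗ f` with `i`, `j` in one block and `f` a weight element. The weights
-- of the former, and of `f`, are integral combinations of `ε_a ∈ G`; `E_{ij}` adds `ε_i - ε_j ∈ G`.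
theorem range_leviHom_le [Module.Finite ℂ A] {G : AddSubgroup (Fin m → ℂ)}
    (hG : ∀ a, eps (e (Sum.inr a)) ∈ G)
    (hc : ∀ i j, c i = c j → eps (e (Sum.inl i)) - eps (e (Sum.inl j)) ∈ G) :
    LinearMap.range (leviHom e A c).toLin ≤
      Submodule.span ℂ {T | ∃ α ∈ G, HasWeight (derToEnd _ T) α} := by
  have hext : ∀ α : Fin q → ℤ, extendWeight e α ∈ G := fun α =>
    AddSubgroup.sum_mem _ fun a _ => AddSubgroup.zsmul_mem _ (hG a) _
  set S := Submodule.span ℂ {T : SuperDer (MvPolynomial (Fin m) ℂ ⊗[ℂ] A) |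
    ∃ α ∈ G, HasWeight (derToEnd _ T) α}
  let L : (SuperDer (MvPolynomial (Fin q) ℂ ⊗[ℂ] A) ×
      blockSubalgebra c ⊗[ℂ] (MvPolynomial (Fin q) ℂ ⊗[ℂ] A)) →ₗ[ℂ]
      SuperDer (MvPolynomial (Fin m) ℂ ⊗[ℂ] A) := (leviHom e A c).toLin
  have h1 : ⊤ ≤ S.comap (L ∘ₗ LinearMap.inl ℂ _ _) := by
    rw [← span_weight_superDer, Submodule.span_le]
    rintro D ⟨α, hα⟩
    refine Submodule.subset_span ⟨_, hext α, hasWeight_lTensor e (fun x => ?_) hα⟩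
    refine (derToEnd_leviHom e A c D 0 x).trans ?_
    rw [map_zero, LinearMap.zero_apply, add_zero]
  have h2 : ∀ i j, (h : c i = c j) → ∀ f : MvPolynomial (Fin q) ℂ ⊗[ℂ] A,
      L (0, (⟨_, single_mem_blockSubalgebra h⟩ : blockSubalgebra c) ⊗ₜ f) ∈ S := by
    intro i j h
    suffices ⊤ ≤ S.comap (L ∘ₗ LinearMap.inr ℂ _ _ ∘ₗ TensorProduct.mk ℂ _ _
        (⟨_, single_mem_blockSubalgebra h⟩ : blockSubalgebra c)) from
      fun f => this (Submodule.mem_top : f ∈ ⊤)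
    rw [← span_weight_elements, Submodule.span_le]
    rintro f ⟨β, hβ⟩
    refine Submodule.subset_span ⟨_, G.add_mem (hc i j h) (hext β),
      hasWeight_map_glDer e i j (fun x => ?_) hβ⟩
    refine (derToEnd_leviHom e A c 0 _ x).trans ?_
    rw [map_zero, LinearMap.lTensor_zero, LinearMap.zero_apply, zero_add]
    rfl
  have h3 : ⊤ ≤ S.comap (L ∘ₗ LinearMap.inr ℂ _ _) := by
    intro u _
    induction u with
    | zero => exact Submodule.zero_mem _
    | add x y hx hy => exact Submodule.add_mem _ (hx trivial) (hy trivial)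
    | tmul x f =>
      -- A block-diagonal matrix is a combination of the matrix units within blocks.
      have hx : x = ∑ i, ∑ j, if h : c i = c j then
          (x : Matrix (Fin r) (Fin r) ℂ) i j •
            (⟨_, single_mem_blockSubalgebra h⟩ : blockSubalgebra c) else 0 := by
        apply (blockSubalgebra c).toSubmodule.injective_subtype
        rw [map_sum]
        refine (Matrix.matrix_eq_sum_single _).trans (Finset.sum_congr rfl fun i _ => ?_)
        rw [map_sum]
        refine Finset.sum_congr rfl fun j _ => ?_
        split_ifs with h
        · simp
        · rw [map_zero]
          exact (congrArg _ (x.2 i j h)).trans (Matrix.single_zero i j)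
      rw [hx, TensorProduct.sum_tmul]
      refine Submodule.sum_mem _ fun i _ => ?_
      rw [TensorProduct.sum_tmul]
      refine Submodule.sum_mem _ fun j _ => ?_
      split_ifs with h
      · rw [← TensorProduct.smul_tmul']
        exact Submodule.smul_mem _ _ (h2 i j h f)
      · rw [TensorProduct.zero_tmul]
        exact Submodule.zero_mem _
  rintro _ ⟨⟨D, u⟩, rfl⟩
  have hsum : (leviHom e A c).toLin (D, u) = L (D, 0) + L (0, u) := by
    rw [← map_add, Prod.mk_add_mk, add_zero, zero_add]; rfl
  rw [hsum]
  exact Submodule.add_mem _ (h1 trivial) (h3 trivial)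

end LeviHom

end

/-! ### The subgroup generated by a set of roots of `𝔰𝔩_{m+1}` -/

section RootGroup

variable {m : ℕ}

/-- The subgroup generated by a set of roots of `𝔰𝔩_{m+1}` splits the indices into those with
`ε_i ∈ G` and blocks of equivalent indices. -/
theorem exists_block_structure {S : Set (Fin m → ℂ)} (hS : S ⊆ slRoots m) :
    ∃ q ≤ m, ∃ (e : Fin (m - q) ⊕ Fin q ≃ Fin m) (c : Fin (m - q) → ℝ),
      (∀ a, eps (e (Sum.inr a)) ∈ AddSubgroup.closure S) ∧
      (∀ i j, c i = c j → eps (e (Sum.inl i)) - eps (e (Sum.inl j)) ∈ AddSubgroup.closure S) ∧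
      ∀ j, ∀ α ∈ AddSubgroup.closure S, ∑ i with c i = c j, α (e (Sum.inl i)) = 0 := by
  classical
  set G := AddSubgroup.closure S with hG
  let p : Fin m → Prop := fun i => eps i ∉ G
  let q := Fintype.card {i // ¬ p i}
  have hq : q ≤ m := (Fintype.card_subtype_le _).trans (Fintype.card_fin m).le
  have hr : Fintype.card {i // p i} = m - q := by
    have h1 := Fintype.card_subtype_compl p
    rw [Fintype.card_fin] at h1
    have h2 : Fintype.card {i // p i} ≤ m :=
      (Fintype.card_subtype_le _).trans (Fintype.card_fin m).le
    have h3 : q = m - Fintype.card {i // p i} := h1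
    omega
  let e : Fin (m - q) ⊕ Fin q ≃ Fin m :=
    (Equiv.sumCongr (Fintype.equivFinOfCardEq hr).symm
      (Fintype.equivFin {i // ¬ p i}).symm).trans (Equiv.sumCompl p)
  have hl : ∀ i, eps (e (Sum.inl i)) ∉ G := fun i => ((Fintype.equivFinOfCardEq hr).symm i).2
  have hr' : ∀ i, eps (e (Sum.inr i)) ∈ G := fun i =>
    not_not.1 ((Fintype.equivFin {i // ¬ p i}).symm i).2
  -- Membership of `ε_i - ε_j` in a subgroup is an equivalence relation; its classes are the blocks.
  let s : Setoid (Fin (m - q)) :=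
    { r := fun i j => eps (e (Sum.inl i)) - eps (e (Sum.inl j)) ∈ G
      iseqv :=
        { refl := fun i => by rw [sub_self]; exact G.zero_mem
          symm := fun {i j} h => by rw [← neg_sub]; exact G.neg_mem h
          trans := fun {i j k} h h' => by
            rw [← sub_add_sub_cancel]; exact G.add_mem h h' } }
  -- Each block is labelled by the number of a chosen representative, so labels agree exactly within
  -- a block.
  let c : Fin (m - q) → ℝ := fun i => (((Quotient.mk s i).out : Fin (m - q)) : ℕ)
  have hc : ∀ i j, c i = c j ↔ eps (e (Sum.inl i)) - eps (e (Sum.inl j)) ∈ G := by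
    intro i j
    rw [Nat.cast_inj, Fin.val_inj, Quotient.out_inj]
    exact Quotient.eq
  refine ⟨q, hq, e, c, hr', fun i j => (hc i j).1, fun j α hα => ?_⟩
  have hsl : ∀ a, ∑ i with c i = c j, (eps (e (Sum.inl a)) : Fin m → ℂ) (e (Sum.inl i)) =
      if c a = c j then 1 else 0 := by
    intro a
    rw [Finset.sum_congr rfl fun i _ => eps_inl_inl e a i]
    simp [eps, Pi.single_apply]
  have hsr : ∀ a, ∑ i with c i = c j, (eps (e (Sum.inr a)) : Fin m → ℂ) (e (Sum.inl i)) = 0 := by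
    intro a
    simp [eps]
  induction hα using AddSubgroup.closure_induction with
  | zero => simp
  | add x y _ _ hx hy => simp only [Pi.add_apply, Finset.sum_add_distrib, hx, hy, add_zero]
  | neg x _ hx => simp only [Pi.neg_apply, Finset.sum_neg_distrib, hx, neg_zero]
  | mem α hα =>
    have hαG : α ∈ G := AddSubgroup.subset_closure hα
    rcases hS hα with ⟨a, b, _, rfl⟩ | ⟨a, rfl⟩ | ⟨a, rfl⟩
    -- A generator `ε_a - ε_b` has both indices in the second group, where its block sums vanish
    -- term by term, or both in one block, where they cancel. In a mixed case `G` would contain the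
    -- `ε` of an index of the first group.
    · obtain ⟨a, rfl⟩ := e.surjective a
      obtain ⟨b, rfl⟩ := e.surjective b
      simp only [Pi.sub_apply, Finset.sum_sub_distrib]
      rcases a with a | a <;> rcases b with b | b
      · rw [hsl, hsl, (hc a b).2 hαG, sub_self]
      · exact absurd (by simpa using G.add_mem hαG (hr' b)) (hl a)
      · exact absurd (by simpa using G.sub_mem (hr' a) hαG) (hl b)
      · rw [hsr, hsr, sub_self]
    · obtain ⟨a, rfl⟩ := e.surjective a
      rcases a with a | a
      · exact absurd hαG (hl a)
      · exact hsr a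
    · obtain ⟨a, rfl⟩ := e.surjective a
      simp only [Pi.neg_apply, Finset.sum_neg_distrib]
      rcases a with a | a
      · exact absurd (G.neg_mem_iff.1 hαG) (hl a)
      · rw [hsr, neg_zero]

end RootGroup

/-! ### Identification of the Levi subalgebra -/

section LeviSpace

variable {m n : ℕ}

theorem derToEnd_adEuler (i : Fin m) (T : W m n) (x : PolyExt m n) :
    derToEnd _ (adEuler m n i T) x =
      eulerOp m n i (derToEnd _ T x) - derToEnd _ T (eulerOp m n i x) := by
  rw [adEuler, derToEnd_br]
  exact LinearMap.congr_fun (superComm_even_left (eulerOp_mem m n i).1 (derToEnd _ T)) x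

/-- On a weight space `W_α` the adjoint action of a block Euler operator is the scalar given by the
block sum of `α`, which is zero for `α ∈ G`. -/
theorem comm_of_mem_leviSpace {q r : ℕ} (e : Fin r ⊕ Fin q ≃ Fin m) (c : Fin r → ℝ)
    {G : AddSubgroup (Fin m → ℂ)}
    (hG0 : ∀ j, ∀ α ∈ G, ∑ i with c i = c j, α (e (Sum.inl i)) = 0) {T : W m n}
    (hT : T ∈ leviSpace (adEuler m n) (roots (adEuler m n) ∩ (G : Set (Fin m → ℂ))))
    (j : Fin r) (x : PolyExt m n) :
    ∑ i with c i = c j, eulerOp m n (e (Sum.inl i)) (derToEnd _ T x) =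
      derToEnd _ T (∑ i with c i = c j, eulerOp m n (e (Sum.inl i)) x) := by
  have hw : ∀ α ∈ G, wtSpace (adEuler m n) α ≤
      LinearMap.ker (∑ i with c i = c j, adEuler m n (e (Sum.inl i))) := by
    intro α hα U hU
    rw [LinearMap.mem_ker, LinearMap.sum_apply]
    simp only [mem_wtSpace.1 hU]
    rw [← Finset.sum_smul, hG0 j α hα, zero_smul]
  have hle : leviSpace (adEuler m n) (roots (adEuler m n) ∩ (G : Set (Fin m → ℂ))) ≤
      LinearMap.ker (∑ i with c i = c j, adEuler m n (e (Sum.inl i))) :=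
    sup_le (hw 0 G.zero_mem) (iSup₂_le fun α hα => hw α hα.2)
  have h := hle hT
  rw [LinearMap.mem_ker, LinearMap.sum_apply] at h
  have h2 := LinearMap.congr_fun (congrArg (derToEnd (PolyExt m n)) h) x
  rw [map_sum, LinearMap.sum_apply] at h2
  simp only [derToEnd_adEuler, Finset.sum_sub_distrib] at h2
  rw [map_zero, LinearMap.zero_apply, sub_eq_zero, ← map_sum] at h2
  exact h2

/-- One inclusion holds because weight vectors with weights in `G` span the image, the other because
the Levi space centralizes the block Euler operators. -/
theorem range_leviHom_eq_leviSpace {q r : ℕ} (e : Fin r ⊕ Fin q ≃ Fin m) (c : Fin r → ℝ)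
    {G : AddSubgroup (Fin m → ℂ)} (hG : ∀ a, eps (e (Sum.inr a)) ∈ G)
    (hc : ∀ i j, c i = c j → eps (e (Sum.inl i)) - eps (e (Sum.inl j)) ∈ G)
    (hG0 : ∀ j, ∀ α ∈ G, ∑ i with c i = c j, α (e (Sum.inl i)) = 0) :
    LinearMap.range (leviHom e (ExteriorAlgebra ℂ (Fin n → ℂ)) c).toLin =
      leviSpace (adEuler m n) (roots (adEuler m n) ∩ (G : Set (Fin m → ℂ))) := by
  apply le_antisymm
  · refine (range_leviHom_le _ hG hc).trans (Submodule.span_le.2 ?_)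
    rintro T ⟨α, hα, hT⟩
    refine wtSpace_le_leviSpace (adEuler m n) subset_rfl hα (mem_wtSpace.2 fun i => ?_)
    refine derToEnd_injective (LinearMap.ext fun x => ?_)
    refine (derToEnd_adEuler i T x).trans (sub_eq_iff_eq_add'.2 ?_)
    exact hT i x
  · intro T hT
    exact mem_range_leviHom e (T := T) (comm_of_mem_leviSpace e c hG0 hT)

end LeviSpace

end

end SuperWitt

theorem mainTheorem8 {m n : ℕ} (hmn : (m, n) ≠ (0, 0))
    {M : Type*} [AddCommGroup M] [Module ℂ M] [SuperWitt.SuperSpace M]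
    (ρ : SuperWitt.LieSuperHom (SuperWitt.W m n) (Module.End ℂ M))
    (hsimple : SuperWitt.IsSimpleRep ρ) (hnontriv : ¬ SuperWitt.IsTrivialRep ρ)
    (hHC : SuperWitt.IsStrongHarishChandra ρ)
    (μ : Fin m → ℂ) (hμ : SuperWitt.IsExtremal ρ μ)
    (P N : Set (Fin m → ℂ))
    (hPN : SuperWitt.IsTriangularDecomp (SuperWitt.finZero ρ μ) P N) :
    ∃ q : ℕ, q ≤ m ∧ ∃ k : SuperWitt.GlSubalgebra (m - q),
      SuperWitt.IsLeviOfGl k ∧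
      ∃ ψ : SuperWitt.LieSuperHom (SuperWitt.LeviModel q n k) (SuperWitt.W m n),
        Function.Injective ψ.toLin ∧
          LinearMap.range ψ.toLin = SuperWitt.leviOfWeight ρ μ P N := by
  -- The zero part of the decomposition of `Δ'` is `Δ'^I`, so `^λΔ^0` unfolds to the roots of
  -- `W_{m,n}` in the subgroup generated by `Δ'^I`.
  obtain ⟨q, hq, e, c, hG, hc, hG0⟩ := SuperWitt.exists_block_structure
    (S := SuperWitt.shadowInf ρ μ) (fun α hα => hα.1)
  exact ⟨q, hq, SuperWitt.blockSubalgebra c, SuperWitt.isLeviOfGl_blockSubalgebra c,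
    SuperWitt.leviHom e (ExteriorAlgebra ℂ (Fin n → ℂ)) c, SuperWitt.leviHom_injective e _ c,
    SuperWitt.range_leviHom_eq_leviSpace e c hG hc hG0⟩
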